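/- Modules are right modules unless said otherwise. Let $R$ be a (left and right) noetherian ring with Jacobson radical $J$ which is semiperfect (that is, $R/J$ is a semisimple ring and idempotents lift modulo $J$) and basic (that is, $R/J$ is a finite direct product of division rings). Let $e\in R$ be a primitive idempotent, put $\Gamma_e := (1-e)R(1-e)$ and $S_e := eR/\operatorname{rad}(eR)$, and let $\langle 1-e\rangle$ be the two-sided ideal of $R$ generated by $1-e$. Assume that the ring $R/\langle 1-e\rangle$ is right artinian (which for noetherian $R$ is equivalent to being left and right artinian). If $\operatorname{Tor}_k^{\Gamma_e}(eR(1-e),(1-e)Re)$ and $\operatorname{Ext}_R^k(S_e,S_e)$ vanish for all but finitely many $k\in\mathbb{N}$, then $S_e$ is self-orthogonal, i.e. $\operatorname{Ext}_R^k(S_e,S_e)=0$ for all $k\ge 1$. -/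

import Mathlib

open CategoryTheory
open scoped TensorProduct MulOpposite

universe u

/-! ### Semiperfect basic rings, primitive idempotents -/

/-- A ring `R` is semiperfect if `R / J(R)` is semisimple and idempotents lift modulo the
Jacobson radical `J(R)`. -/
structure IsSemiperfectRing (R : Type u) [Ring R] : Prop where
  isSemisimpleRing : IsSemisimpleRing (R ⧸ Ring.jacobson R)
  lift_idempotent : ∀ x : R, x * x - x ∈ Ring.jacobson R →
    ∃ f : R, IsIdempotentElem f ∧ f - x ∈ Ring.jacobson R

/-- A semiperfect ring `R` is basic if `R / J(R)` is a finite direct product of division rings. -/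
def IsBasicRing (R : Type u) [Ring R] : Prop :=
  ∃ (n : ℕ) (D : Fin n → Type u) (_ : ∀ i, DivisionRing (D i)),
    Nonempty ((R ⧸ Ring.jacobson R) ≃+* ∀ i, D i)

/-- A primitive idempotent: a nonzero idempotent that is not the sum of two nonzero orthogonal
idempotents. -/
structure IsPrimitiveIdempotent {R : Type u} [Ring R] (e : R) : Prop where
  isIdempotentElem : IsIdempotentElem e
  ne_zero : e ≠ 0
  eq_zero_or_eq_zero : ∀ f g : R, IsIdempotentElem f → IsIdempotentElem g →
    f * g = 0 → g * f = 0 → e = f + g → f = 0 ∨ g = 0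

/-! ### Right modules: a right `R`-module is a module over `Rᵐᵒᵖ` -/

/-- The right ideal `eR`. -/
abbrev principalRightIdeal {R : Type u} [Ring R] (e : R) : Submodule Rᵐᵒᵖ R :=
  Submodule.span Rᵐᵒᵖ {e}

/-- The right `R`-module `S_e = eR / rad(eR)`, where `rad` is the intersection of all maximal
submodules. -/
abbrev topModule {R : Type u} [Ring R] (e : R) : Type u :=
  principalRightIdeal e ⧸ Module.jacobson Rᵐᵒᵖ (principalRightIdeal e)

/-- The quotient ring `R / ⟨x⟩` by the two-sided ideal generated by `x`. -/
abbrev quotientBySpan {R : Type u} [Ring R] (x : R) : Type u :=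
  (TwoSidedIdeal.span {x}).ringCon.Quotient

/-! ### Peirce components `eRf` as modules over the corner rings -/

/-- The additive subgroup `eRf` of `R`. -/
def peirceComponent {R : Type u} [Ring R] (e f : R) : AddSubgroup R where
  carrier := {x | ∃ r : R, e * r * f = x}
  add_mem' := by
    rintro _ _ ⟨a, rfl⟩ ⟨b, rfl⟩
    exact ⟨a + b, by simp only [mul_add, add_mul]⟩
  zero_mem' := ⟨0, by simp only [mul_zero, zero_mul]⟩
  neg_mem' := by
    rintro _ ⟨a, rfl⟩
    exact ⟨-a, by simp only [mul_neg, neg_mul]⟩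

/-- For an idempotent `f`, the group `eRf` is a right module over the corner ring `fRf`
by multiplication in `R`. -/
instance peirceRightModule {R : Type u} [Ring R] (e : R) {f : R} (hf : IsIdempotentElem f) :
    Module (hf.Corner)ᵐᵒᵖ (peirceComponent e f) where
  smul a x := ⟨x.1 * a.unop.1, by
    obtain ⟨r, hr⟩ := x.2
    have ha := ((Subsemigroup.mem_corner_iff hf).mp a.unop.2).2
    exact ⟨r * f * a.unop.1, by rw [← hr]; simp only [mul_assoc, ha]⟩⟩
  one_smul x := Subtype.ext (by
    obtain ⟨_, r, rfl⟩ := x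
    change e * r * f * f = e * r * f
    rw [mul_assoc, hf.eq])
  mul_smul a b x := Subtype.ext (mul_assoc x.1 b.unop.1 a.unop.1).symm
  smul_zero a := Subtype.ext (zero_mul a.unop.1)
  smul_add a x y := Subtype.ext (add_mul x.1 y.1 a.unop.1)
  add_smul a b x := Subtype.ext (mul_add x.1 a.unop.1 b.unop.1)
  zero_smul x := Subtype.ext (mul_zero x.1)

/-- For an idempotent `f`, the group `fRe` is a left module over the corner ring `fRf`
by multiplication in `R`. -/
instance peirceLeftModule {R : Type u} [Ring R] {f : R} (hf : IsIdempotentElem f) (e : R) :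
    Module hf.Corner (peirceComponent f e) where
  smul a x := ⟨a.1 * x.1, by
    obtain ⟨r, hr⟩ := x.2
    have ha := ((Subsemigroup.mem_corner_iff hf).mp a.2).1
    exact ⟨a.1 * f * r, by rw [← hr]; simp only [← mul_assoc, ha]⟩⟩
  one_smul x := Subtype.ext (by
    obtain ⟨_, r, rfl⟩ := x
    change f * (f * r * e) = f * r * e
    simp only [← mul_assoc, hf.eq])
  mul_smul a b x := Subtype.ext (mul_assoc a.1 b.1 x.1)
  smul_zero a := Subtype.ext (mul_zero a.1)
  smul_add a x y := Subtype.ext (mul_add a.1 x.1 y.1)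
  add_smul a b x := Subtype.ext (add_mul a.1 b.1 x.1)
  zero_smul x := Subtype.ext (zero_mul x.1)

/-! ### Tensor product and `Tor` over a not necessarily commutative ring -/

section NCTensor

variable (A : Type u) [Ring A]

/-- The subgroup of `M ⊗[ℤ] N` generated by all `m a ⊗ n - m ⊗ a n`. -/
def ncTensorRel (M N : Type u) [AddCommGroup M] [Module Aᵐᵒᵖ M] [AddCommGroup N] [Module A N] :
    AddSubgroup (M ⊗[ℤ] N) :=
  AddSubgroup.closure {t | ∃ (m : M) (a : A) (n : N),
    t = (MulOpposite.op a • m) ⊗ₜ[ℤ] n - m ⊗ₜ[ℤ] (a • n)}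

/-- The tensor product `M ⊗_A N` of a right `A`-module `M` and a left `A`-module `N`, an abelian
group. -/
abbrev NCTensor (M N : Type u) [AddCommGroup M] [Module Aᵐᵒᵖ M] [AddCommGroup N] [Module A N] :
    Type u :=
  (M ⊗[ℤ] N) ⧸ ncTensorRel A M N

/-- The map `f ⊗ N : M ⊗_A N → M' ⊗_A N`. -/
def ncTensorMap {M M' : Type u} (N : Type u) [AddCommGroup M] [Module Aᵐᵒᵖ M]
    [AddCommGroup M'] [Module Aᵐᵒᵖ M'] [AddCommGroup N] [Module A N] (f : M →ₗ[Aᵐᵒᵖ] M') :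
    NCTensor A M N →+ NCTensor A M' N :=
  QuotientAddGroup.map (ncTensorRel A M N) (ncTensorRel A M' N)
    (LinearMap.rTensor N f.toAddMonoidHom.toIntLinearMap).toAddMonoidHom (by
      refine (AddSubgroup.closure_le _).mpr ?_
      rintro _ ⟨m, a, n, rfl⟩
      refine AddSubgroup.subset_closure ⟨f m, a, n, ?_⟩
      rw [← f.map_smul, map_sub]
      rfl)

@[simp]
theorem ncTensorMap_mk_tmul {M M' : Type u} (N : Type u) [AddCommGroup M] [Module Aᵐᵒᵖ M]
    [AddCommGroup M'] [Module Aᵐᵒᵖ M'] [AddCommGroup N] [Module A N] (f : M →ₗ[Aᵐᵒᵖ] M')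
    (m : M) (n : N) :
    ncTensorMap A N f (QuotientAddGroup.mk (m ⊗ₜ[ℤ] n)) =
      QuotientAddGroup.mk (f m ⊗ₜ[ℤ] n) := rfl

theorem ncTensor_hom_ext {M N : Type u} [AddCommGroup M] [Module Aᵐᵒᵖ M]
    [AddCommGroup N] [Module A N] {P : Type u} [AddCommGroup P]
    {f g : NCTensor A M N →+ P}
    (h : ∀ (m : M) (n : N), f (QuotientAddGroup.mk (m ⊗ₜ[ℤ] n)) =
      g (QuotientAddGroup.mk (m ⊗ₜ[ℤ] n))) : f = g := by
  refine QuotientAddGroup.addMonoidHom_ext _ (AddMonoidHom.ext fun t => ?_)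
  induction t using TensorProduct.induction_on with
  | zero => rw [map_zero, map_zero]
  | tmul m n => exact h m n
  | add x y hx hy => rw [map_add, map_add, hx, hy]

/-- The functor `- ⊗_A N` from right `A`-modules to abelian groups. -/
def ncTensorFunctor (N : Type u) [AddCommGroup N] [Module A N] :
    ModuleCat.{u} Aᵐᵒᵖ ⥤ AddCommGrpCat.{u} where
  obj M := AddCommGrpCat.of (NCTensor A M N)
  map f := AddCommGrpCat.ofHom (ncTensorMap A N f.hom)
  map_id _ := AddCommGrpCat.hom_ext (ncTensor_hom_ext A fun _ _ => rfl)
  map_comp _ _ := AddCommGrpCat.hom_ext (ncTensor_hom_ext A fun _ _ => rfl)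

instance ncTensorFunctor_additive (N : Type u) [AddCommGroup N] [Module A N] :
    (ncTensorFunctor A N).Additive where
  map_add {_ _ f g} := AddCommGrpCat.hom_ext (ncTensor_hom_ext A fun m n =>
    congrArg QuotientAddGroup.mk (TensorProduct.add_tmul (f.hom m) (g.hom m) n))

/-- `Tor_k^A(M, N)`: the `k`-th left derived functor of `- ⊗_A N` evaluated at `M`. -/
noncomputable def NCTor (k : ℕ) (M N : Type u) [AddCommGroup M] [Module Aᵐᵒᵖ M]
    [AddCommGroup N] [Module A N] : AddCommGrpCat.{u} :=
  ((ncTensorFunctor A N).leftDerived k).obj (ModuleCat.of Aᵐᵒᵖ M)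

end NCTensor

/-! ### Extensions of right modules -/

/-- The group `Ext_R^k(M, N)` of right `R`-modules. -/
abbrev rightExt (R : Type u) [Ring R] (k : ℕ) (M N : Type u) [AddCommGroup M] [Module Rᵐᵒᵖ M]
    [AddCommGroup N] [Module Rᵐᵒᵖ N] : Type u :=
  Abelian.Ext (ModuleCat.of Rᵐᵒᵖ M) (ModuleCat.of Rᵐᵒᵖ N) k

/-! ### Ring theory of primitive idempotents -/

section RingTheory

variable {R : Type u} [Ring R]

/-! Write `f = 1 - e` and `S = S_e`. The proof plays the Ext groups of a module into `S` against a
homology theory that hardly sees `S`. Build a complex `C` of projective left modules with `Re` in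
degree 0 and sums of copies of `Rf` in positive degrees, where each differential covers the `f`-part
of the cycles before it. Let `H_j(M)` be the homology of `M ⊗_R C` in degree `j`; its vanishing is
`MatChain.Acyc M j`, which tests index `j + 1` because index 0 is the zero module.

Three computations drive everything. `H_j(fR) = 0` for all `j`, by construction. `H_j(S) = 0` for `j
≥ 1`, because `Sf = 0`. For `eR`, `H_0(eR) ≠ 0` because `eRf` lies in the radical, and `H_{j+2}(eR)`
vanishes with `Tor_{j+1}` over `fRf`, because `fC` in positive degrees is a free resolution of
`fRe`. By the Tor hypothesis there is a largest `m` with `H_m(eR) ≠ 0`.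

Suppose `n + 1` is the largest degree with `Ext^{n+1}(M, S) ≠ 0`, for a finitely generated `M`. Then
`H_{m+n+1}(M) ≠ 0` (`not_acyc_of_rightExt`); with `M = S` this contradicts `H_j(S) = 0`. To prove
it, cover `M` by sums of copies of `eR` and `fR` whose kernels are radical in the `eR`-coordinates
(`exists_cover`). Passing to the kernel lowers Ext degrees by one, and, as `H_j` of the covers
vanishes for `j > m`, nonvanishing homology in degrees above `m` can be carried back from the kernel
to `M`.

The critical step is degree `m`, where the cover `P` may have homology. The kernel `K` then has
`Hom(K, S) ≠ 0` and no higher Ext. So `K` has a cover with a summand `eR` and with a kernel without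
homology (`acyc_of_subsingleton_rightExt`), and `H_m(eR)` embeds in `H_m(K)`. On `H_m(eR)` the ring
acts through `R/⟨f⟩`, whose radical is nilpotent by the artinian hypothesis, so some nonzero class
is killed by the radical (`exists_socle_cycle`). Its image in `H_m(K)` is nonzero but dies in
`H_m(P)`, because `K → P` is radical in the `eR`-coordinates and `fR` has no homology. Hence it
comes from `H_{m+1}(M)`. -/

theorem isUnit_one_add_of_mem_jacobson {x : R} (hx : x ∈ Ring.jacobson R) : IsUnit (1 + x) := by
  have key : ∀ y ∈ Ring.jacobson R, ∃ z : R, z * (1 + y) = 1 := by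
    intro y hy
    rw [← Ideal.jacobson_bot, Ideal.mem_jacobson_iff] at hy
    obtain ⟨z, hz⟩ := hy 1
    refine ⟨z, ?_⟩
    rw [Submodule.mem_bot] at hz
    rw [mul_add, ← sub_eq_zero, ← hz]
    noncomm_ring
  obtain ⟨z, hz⟩ := key x hx
  have hz' : z = 1 + -(z * x) := by
    rw [← hz]
    noncomm_ring
  -- The left inverse `z = 1 - zx` is again one plus a radical element, so it has a left inverse
  -- too; hence `z` is a two-sided inverse.
  obtain ⟨w, hw⟩ := key (-(z * x)) (neg_mem (Ideal.mul_mem_left _ _ hx))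
  rw [← hz'] at hw
  have hwx : w = 1 + x := by
    calc w = w * (z * (1 + x)) := by rw [hz, mul_one]
      _ = 1 + x := by rw [← mul_assoc, hw, one_mul]
  exact ⟨⟨1 + x, z, hwx ▸ hw, hz⟩, rfl⟩

theorem isUnit_one_sub_of_mem_jacobson {x : R} (hx : x ∈ Ring.jacobson R) : IsUnit (1 - x) := by
  rw [sub_eq_add_neg]
  exact isUnit_one_add_of_mem_jacobson (neg_mem hx)

/-- An idempotent in the Jacobson radical is zero. -/
theorem IsIdempotentElem.eq_zero_of_mem_jacobson {x : R} (h : IsIdempotentElem x)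
    (hx : x ∈ Ring.jacobson R) : x = 0 := by
  have := isUnit_one_sub_of_mem_jacobson hx
  rw [← this.mul_right_eq_zero, sub_mul, one_mul, h.eq, sub_self]

/-- Idempotents of a corner ring lift modulo the Jacobson radical. -/
theorem IsSemiperfectRing.lift_idempotent_corner (hR : IsSemiperfectRing R) {e : R}
    (he : IsIdempotentElem e) (x : R) (hex : e * x = x) (hxe : x * e = x)
    (hx : x * x - x ∈ Ring.jacobson R) :
    ∃ g : R, IsIdempotentElem g ∧ e * g = g ∧ g * e = g ∧ g - x ∈ Ring.jacobson R := by
  obtain ⟨f, hf, hfx⟩ := hR.lift_idempotent x hx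
  have hj : f * (1 - e) ∈ Ring.jacobson R := by
    have : f * (1 - e) = (f - x) * (1 - e) := by
      rw [sub_mul, mul_sub x, hxe, mul_one, sub_self, sub_zero]
    rw [this]
    exact Ideal.mul_mem_right _ _ hfx
  -- Conjugating `f` by the unit `u = 1 - f(1 - e)`, which is congruent to 1, makes it absorb `e` on
  -- the right, since `fu = fe`. Multiplying by `e` on the left then moves it into `eRe`.
  obtain ⟨u, hu⟩ := isUnit_one_sub_of_mem_jacobson hj
  have hfu : f * u = f * e := by
    rw [hu, mul_sub, ← mul_assoc, hf.eq]
    noncomm_ring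
  have huinv : (↑u⁻¹ : R) - 1 ∈ Ring.jacobson R := by
    have : (↑u⁻¹ : R) - 1 = ↑u⁻¹ * (f * (1 - e)) := by
      have h1 : f * (1 - e) = 1 - u := by rw [hu]; abel
      rw [h1, mul_sub, Units.inv_mul, mul_one]
    rw [this]
    exact Ideal.mul_mem_left _ _ hj
  set g₁ : R := ↑u⁻¹ * f * u with hg₁
  have hg₁e : g₁ * e = g₁ := by
    rw [hg₁, mul_assoc _ f, hfu, mul_assoc, mul_assoc, he.eq]
  have hg₁i : g₁ * g₁ = g₁ := by
    calc g₁ * g₁ = ↑u⁻¹ * (f * (↑u * ↑u⁻¹) * f) * u := by rw [hg₁]; noncomm_ring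
      _ = g₁ := by rw [Units.mul_inv, mul_one, hf.eq]
  have hg₁x : g₁ - x ∈ Ring.jacobson R := by
    have : g₁ - x = (↑u⁻¹ - 1) * (f * u) + (f - x) - f * (1 - u) := by
      rw [hg₁]; noncomm_ring
    rw [this]
    refine sub_mem (add_mem (Ideal.mul_mem_right _ _ huinv) hfx) (Ideal.mul_mem_left _ _ ?_)
    have h1 : (1 : R) - u = f * (1 - e) := by rw [hu]; abel
    rwa [h1]
  refine ⟨e * g₁, ?_, by rw [← mul_assoc, he.eq], by rw [mul_assoc, hg₁e], ?_⟩
  · change e * g₁ * (e * g₁) = e * g₁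
    rw [mul_assoc, ← mul_assoc g₁, hg₁e, hg₁i]
  · have : e * g₁ - x = e * (g₁ - x) := by rw [mul_sub, hex]
    rw [this]
    exact Ideal.mul_mem_left _ _ hg₁x

/-- The facts on a primitive idempotent `e` of a basic semiperfect ring with radical `J` which
say that `eRe` is local and that `eR(1-e)` and `(1-e)Re` lie in `J`. -/
structure IsLocalPeirce (e : R) : Prop where
  idem : IsIdempotentElem e
  notMem : e ∉ Ring.jacobson R
  right : ∀ r, e * r * (1 - e) ∈ Ring.jacobson R
  inv : ∀ x, e * x * e ∉ Ring.jacobson R →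
    ∃ y, e - (e * x * e) * (e * y * e) ∈ Ring.jacobson R

/-- In a product of division rings an idempotent has coordinates 0 and 1, so `e` is central modulo
the radical, which gives the `right` field. Primitivity leaves exactly one coordinate equal to 1, so
`eRe` modulo its radical part is a division ring. -/
theorem IsPrimitiveIdempotent.isLocalPeirce (hR : IsSemiperfectRing R) (hb : IsBasicRing R)
    {e : R} (he : IsPrimitiveIdempotent e) : IsLocalPeirce e := by
  have hi := he.isIdempotentElem
  have hnot : e ∉ Ring.jacobson R := fun h => he.ne_zero (hi.eq_zero_of_mem_jacobson h)
  obtain ⟨n, D, inst, ⟨φ⟩⟩ := hb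
  set p : R →+* (∀ i, D i) := φ.toRingHom.comp (Ideal.Quotient.mk _) with hp
  have hpJ : ∀ x, p x = 0 ↔ x ∈ Ring.jacobson R := by
    intro x
    rw [hp, RingHom.comp_apply]
    change φ _ = 0 ↔ _
    rw [map_eq_zero_iff φ φ.injective]
    exact Ideal.Quotient.eq_zero_iff_mem
  have hps : Function.Surjective p := φ.surjective.comp Ideal.Quotient.mk_surjective
  have hpe : ∀ i, p e i = 0 ∨ p e i = 1 := by
    intro i
    have : p e i * p e i = p e i := by
      rw [← Pi.mul_apply, ← map_mul, hi.eq]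
    rcases eq_or_ne (p e i) 0 with h | h
    · exact Or.inl h
    · exact Or.inr (mul_left_cancel₀ h (by rw [this, mul_one]))
  obtain ⟨i, hie⟩ : ∃ i, p e i = 1 := by
    by_contra hcon
    push Not at hcon
    exact hnot ((hpJ e).1 (funext fun i => (hpe i).resolve_right (hcon i)))
  obtain ⟨x₀, hx₀⟩ := hps (Pi.single i 1)
  -- The `i`-th coordinate idempotent lifts to an idempotent `g` of `eRe`. Primitivity of `e = g +
  -- (e - g)` forces `g = e`, as `g` is nonzero.
  have hsingle : ∀ j, j ≠ i → p e j = 0 := by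
    have hx : p (e * x₀ * e) = Pi.single i 1 := by
      rw [map_mul, map_mul, hx₀]
      ext j
      rcases eq_or_ne j i with rfl | h
      · simp [hie]
      · simp [Pi.single_eq_of_ne h]
    obtain ⟨g, hg, heg, hge, hgx⟩ := hR.lift_idempotent_corner hi (e * x₀ * e)
      (by rw [← mul_assoc, ← mul_assoc, hi.eq]) (by rw [mul_assoc, hi.eq]) (by
        rw [← hpJ, map_sub, map_mul, hx, ← Pi.single_mul, one_mul, sub_self])
    have hpg : p g = Pi.single i 1 := by
      rw [← hx, ← sub_eq_zero, ← map_sub, hpJ]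
      exact hgx
    intro j hj
    rcases he.eq_zero_or_eq_zero g (e - g) hg
      (by change (e - g) * (e - g) = e - g
          rw [sub_mul, mul_sub, mul_sub, hi.eq, heg, hge, hg.eq, sub_self, sub_zero])
      (by rw [mul_sub, hge, hg.eq, sub_self]) (by rw [sub_mul, heg, hg.eq, sub_self])
      (by abel) with h | h
    · rw [h, map_zero] at hpg
      have := congrFun hpg i
      simp at this
    · rw [sub_eq_zero.1 h, hpg, Pi.single_eq_of_ne hj]
  have hcomm : ∀ r, p (e * r) = p (r * e) := by
    intro r
    ext j
    rw [map_mul, map_mul, Pi.mul_apply, Pi.mul_apply]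
    rcases hpe j with h | h <;> rw [h] <;> simp
  refine ⟨hi, hnot, fun r => ?_, fun x hx => ?_⟩
  · rw [← hpJ, map_mul, hcomm, ← map_mul, mul_assoc, mul_sub, hi.eq, mul_one, sub_self, mul_zero,
      map_zero]
  · have hxi : p (e * x * e) i ≠ 0 := by
      intro h
      refine hx ((hpJ _).1 (funext fun j => ?_))
      rcases eq_or_ne j i with rfl | hj
      · exact h
      · rw [map_mul, Pi.mul_apply, hsingle j hj, mul_zero]
        rfl
    obtain ⟨y, hy⟩ := hps (Pi.single i (p (e * x * e) i)⁻¹)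
    refine ⟨y, (hpJ _).1 (funext fun j => ?_)⟩
    rw [map_sub, map_mul, map_mul _ (e * y), map_mul _ e y, hy]
    rcases eq_or_ne j i with rfl | hj
    · simp only [Pi.sub_apply, Pi.mul_apply, hie, Pi.single_eq_same, one_mul, mul_one,
        Pi.zero_apply, mul_inv_cancel₀ hxi, sub_self]
    · simp [hsingle j hj]

theorem op_list_prod_mem_pow (I : Ideal Rᵐᵒᵖ) (l : List R)
    (h : ∀ x ∈ l, MulOpposite.op x ∈ I) : MulOpposite.op l.prod ∈ I ^ l.length := by
  induction l with
  | nil => exact Submodule.one_le.1 le_rfl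
  | cons x l ih =>
    rw [List.prod_cons, MulOpposite.op_mul, List.length_cons, Submodule.pow_succ]
    exact Ideal.mul_mem_mul (ih fun y hy => h y (List.mem_cons_of_mem _ hy))
      (h x List.mem_cons_self)

/-- If `q : R → B` is surjective and `B` is right artinian then some power of the Jacobson radical
of `R` is killed by `q`. -/
theorem exists_map_list_prod_eq_zero {B : Type u} [Ring B] [IsArtinianRing Bᵐᵒᵖ] (q : R →+* B)
    (hq : Function.Surjective q) :
    ∃ N : ℕ, ∀ l : List R, (∀ x ∈ l, x ∈ Ring.jacobson R) → l.length = N → q l.prod = 0 := by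
  obtain ⟨N, hN⟩ := IsArtinianRing.isNilpotent_jacobson_bot (R := Bᵐᵒᵖ)
  set I := Ideal.jacobson (⊥ : Ideal Bᵐᵒᵖ) with hI
  -- The radical of `R` is defined by left ideals and `I` by right ideals of `B`; invertibility of
  -- `1 + xr` bridges the two sides.
  have key : ∀ x ∈ Ring.jacobson R, MulOpposite.op (q x) ∈ I := by
    intro x hx
    rw [hI, Ideal.mem_jacobson_iff]
    intro y
    obtain ⟨r, hr⟩ := hq y.unop
    obtain ⟨v, hv⟩ := isUnit_one_add_of_mem_jacobson
      (x := x * r) (Ideal.mul_mem_right _ _ hx)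
    refine ⟨MulOpposite.op (q (↑v⁻¹ : R)), ?_⟩
    rw [Submodule.mem_bot]
    apply MulOpposite.unop_injective
    simp only [MulOpposite.unop_sub, MulOpposite.unop_add, MulOpposite.unop_mul,
      MulOpposite.unop_op, MulOpposite.unop_one, MulOpposite.unop_zero]
    rw [← hr, ← map_mul, ← map_mul, ← map_add, ← map_one q, ← map_sub]
    have : x * (r * ↑v⁻¹) + ↑v⁻¹ - 1 = 0 := by
      have h2 := v.mul_inv
      rw [hv] at h2
      rw [← h2]
      noncomm_ring
    rw [this, map_zero]
  refine ⟨N, fun l hl hlen => ?_⟩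
  have h3 := op_list_prod_mem_pow I (l.map q) (by
    intro x hx
    obtain ⟨y, hy, rfl⟩ := List.mem_map.1 hx
    exact key y (hl y hy))
  rw [← map_list_prod, List.length_map, hlen, hN] at h3
  exact MulOpposite.op_injective (by simpa using h3)

/-- If `R / K` is right artinian then some power of the Jacobson radical of `R` lies in `K`. -/
theorem exists_list_prod_mem_of_isArtinianRing (K : TwoSidedIdeal R)
    (hK : IsArtinianRing (K.ringCon.Quotient)ᵐᵒᵖ) :
    ∃ N : ℕ, ∀ l : List R, (∀ x ∈ l, x ∈ Ring.jacobson R) → l.length = N → l.prod ∈ K := by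
  obtain ⟨N, hN⟩ := exists_map_list_prod_eq_zero K.ringCon.mk' (RingCon.mk'_surjective _)
  refine ⟨N, fun l hl hlen => ?_⟩
  have h5 : K.ringCon l.prod 0 := (RingCon.eq _).1 (hN l hl hlen)
  rwa [TwoSidedIdeal.rel_iff, sub_zero] at h5

end RingTheory

/-! ### Complexes `M ⊗ D` given by row-finite matrices -/

section Matrices

/-- The map of finitely supported functions induced by an additive map of the values. -/
noncomputable def finsuppMap {M M' : Type u} [AddCommGroup M] [AddCommGroup M'] (I : Type u)
    (φ : M →+ M') : (I →₀ M) →+ (I →₀ M') :=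
  Finsupp.mapRange.addMonoidHom φ

@[simp]
theorem finsuppMap_apply {M M' : Type u} [AddCommGroup M] [AddCommGroup M'] {I : Type u}
    (φ : M →+ M') (v : I →₀ M) (i : I) : finsuppMap I φ v i = φ (v i) := rfl

@[simp]
theorem finsuppMap_single {M M' : Type u} [AddCommGroup M] [AddCommGroup M'] {I : Type u}
    (φ : M →+ M') (i : I) (m : M) :
    finsuppMap I φ (Finsupp.single i m) = Finsupp.single i (φ m) := by
  simp [finsuppMap]

theorem finsuppMap_injective {M M' : Type u} [AddCommGroup M] [AddCommGroup M'] (I : Type u)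
    {φ : M →+ M'} (hφ : Function.Injective φ) : Function.Injective (finsuppMap I φ) :=
  Finsupp.mapRange_injective φ (map_zero φ) hφ

theorem finsuppMap_surjective {M M' : Type u} [AddCommGroup M] [AddCommGroup M'] (I : Type u)
    {φ : M →+ M'} (hφ : Function.Surjective φ) : Function.Surjective (finsuppMap I φ) :=
  Finsupp.mapRange_surjective φ (map_zero φ) hφ

theorem exists_finsuppMap_eq {M M' : Type u} [AddCommGroup M] [AddCommGroup M'] {I : Type u}
    (φ : M →+ M') (y : I →₀ M') (hy : ∀ i, ∃ m, φ m = y i) : ∃ v, finsuppMap I φ v = y := by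
  classical
  induction y using Finsupp.induction with
  | zero => exact ⟨0, map_zero _⟩
  | single_add i m y hi hm ih =>
    obtain ⟨v, hv⟩ := ih (by
      intro i'
      by_cases h : i' = i
      · subst h
        exact ⟨0, by rw [map_zero, Finsupp.notMem_support_iff.1 hi]⟩
      · obtain ⟨n, hn⟩ := hy i'
        exact ⟨n, by rw [hn, Finsupp.add_apply, Finsupp.single_apply, if_neg (Ne.symm h),
          zero_add]⟩)
    obtain ⟨n, hn⟩ := hy i
    rw [Finsupp.add_apply, Finsupp.single_apply, if_pos rfl, Finsupp.notMem_support_iff.1 hi,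
      add_zero] at hn
    exact ⟨Finsupp.single i n + v, by rw [map_add, hv, finsuppMap_single, hn]⟩

variable {L : Type u} [Ring L]

/-- The map `M^{(I')} → M^{(I)}` given by a matrix with rows `a i ∈ L^{(I)}`. -/
noncomputable def rowMap {I' I : Type u} (a : I' → (I →₀ L)) (M : Type u) [AddCommGroup M]
    [Module Lᵐᵒᵖ M] : (I' →₀ M) →+ (I →₀ M) :=
  Finsupp.liftAddHom fun i =>
    { toFun := fun m => (a i).mapRange (fun r => MulOpposite.op r • m) (by simp)
      map_zero' := by ext; simp
      map_add' := fun m n => by ext; simp }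

theorem rowMap_single {I' I : Type u} (a : I' → (I →₀ L)) {M : Type u} [AddCommGroup M]
    [Module Lᵐᵒᵖ M] (i : I') (m : M) (k : I) :
    rowMap a M (Finsupp.single i m) k = MulOpposite.op (a i k) • m := by
  simp [rowMap]

theorem rowMap_single_one {I' I : Type u} (a : I' → (I →₀ L)) (i : I') :
    rowMap a L (Finsupp.single i 1) = a i := by
  ext k
  rw [rowMap_single]
  exact one_mul _

theorem finsuppMap_rowMap {I' I : Type u} (a : I' → (I →₀ L)) {M M' : Type u} [AddCommGroup M]
    [Module Lᵐᵒᵖ M] [AddCommGroup M'] [Module Lᵐᵒᵖ M'] (φ : M →ₗ[Lᵐᵒᵖ] M') (v : I' →₀ M) :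
    finsuppMap I φ.toAddMonoidHom (rowMap a M v) =
      rowMap a M' (finsuppMap I' φ.toAddMonoidHom v) := by
  refine DFunLike.congr_fun (f := (finsuppMap I φ.toAddMonoidHom).comp (rowMap a M))
    (g := (rowMap a M').comp (finsuppMap I' φ.toAddMonoidHom)) ?_ v
  refine Finsupp.addHom_ext fun i m => ?_
  ext k
  simp [rowMap_single]

/-- The right linear map `L → M` sending `1` to `m`. -/
def orbitMap {M : Type u} [AddCommGroup M] [Module Lᵐᵒᵖ M] (m : M) : L →ₗ[Lᵐᵒᵖ] M where
  toFun r := MulOpposite.op r • m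
  map_add' r s := by rw [MulOpposite.op_add, add_smul]
  map_smul' s r := by
    rw [RingHom.id_apply, smul_smul]
    rfl

theorem rowMap_single_eq {I' I : Type u} (a : I' → (I →₀ L)) {M : Type u} [AddCommGroup M]
    [Module Lᵐᵒᵖ M] (i : I') (m : M) :
    rowMap a M (Finsupp.single i m) = finsuppMap I (orbitMap m).toAddMonoidHom (a i) := by
  ext k
  rw [rowMap_single]
  rfl

/-- On a single entry `m` the composite is the image of `rowMap a L (b i)` under the linear map `1 ↦
m`, so the relation over `L` implies it for all coefficients. -/
theorem rowMap_rowMap_eq_zero {I'' I' I : Type u} (b : I'' → (I' →₀ L)) (a : I' → (I →₀ L))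
    (hab : ∀ i, rowMap a L (b i) = 0) {M : Type u} [AddCommGroup M] [Module Lᵐᵒᵖ M]
    (v : I'' →₀ M) : rowMap a M (rowMap b M v) = 0 := by
  refine DFunLike.congr_fun (f := (rowMap a M).comp (rowMap b M)) (g := 0) ?_ v
  refine Finsupp.addHom_ext fun i m => ?_
  rw [AddMonoidHom.comp_apply, rowMap_single_eq, ← finsuppMap_rowMap, hab, map_zero,
    AddMonoidHom.zero_apply]

/-- A complex of projective left modules `(L h_j)^{(I_j)}` with differentials given by matrices. -/
structure MatChain (L : Type u) [Ring L] where
  /-- the index sets -/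
  I : ℕ → Type u
  /-- the idempotents -/
  h : ℕ → L
  /-- the matrices -/
  a : ∀ j, I (j + 1) → (I j →₀ L)
  idem : ∀ j, IsIdempotentElem (h j)
  left : ∀ j i k, h (j + 1) * a j i k = a j i k
  right : ∀ j i k, a j i k * h j = a j i k
  comp : ∀ j i, rowMap (a j) L (a (j + 1) i) = 0

namespace MatChain

variable (C : MatChain L)

/-- The differential of the complex with coefficients in `M`. -/
noncomputable def d (M : Type u) [AddCommGroup M] [Module Lᵐᵒᵖ M] (j : ℕ) :
    (C.I (j + 1) →₀ M) →+ (C.I j →₀ M) :=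
  rowMap (C.a j) M

/-- The action of the idempotent `h j`. -/
noncomputable def proj (M : Type u) [AddCommGroup M] [Module Lᵐᵒᵖ M] (j : ℕ) :
    (C.I j →₀ M) →+ (C.I j →₀ M) :=
  finsuppMap _ (DistribSMul.toAddMonoidHom M (MulOpposite.op (C.h j)))

/-- Exactness at index `j + 1` of the complex with coefficients in `M`. -/
def Acyc (M : Type u) [AddCommGroup M] [Module Lᵐᵒᵖ M] (j : ℕ) : Prop :=
  ∀ v : C.I (j + 1) →₀ M, C.proj M (j + 1) v = v → C.d M j v = 0 →
    ∃ w : C.I (j + 2) →₀ M, C.d M (j + 1) w = v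

variable {M : Type u} [AddCommGroup M] [Module Lᵐᵒᵖ M]
  {M' : Type u} [AddCommGroup M'] [Module Lᵐᵒᵖ M']

theorem proj_apply (j : ℕ) (v : C.I j →₀ M) (i : C.I j) :
    C.proj M j v i = MulOpposite.op (C.h j) • v i := rfl

theorem proj_proj (j : ℕ) (v : C.I j →₀ M) : C.proj M j (C.proj M j v) = C.proj M j v := by
  ext i
  rw [proj_apply, proj_apply, smul_smul, ← MulOpposite.op_mul, (C.idem j).eq]

theorem d_single (j : ℕ) (i : C.I (j + 1)) (m : M) (k : C.I j) :
    C.d M j (Finsupp.single i m) k = MulOpposite.op (C.a j i k) • m :=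
  rowMap_single _ _ _ _

theorem proj_single (j : ℕ) (i : C.I j) (m : M) :
    C.proj M j (Finsupp.single i m) = Finsupp.single i (MulOpposite.op (C.h j) • m) :=
  finsuppMap_single _ _ _

theorem proj_d (j : ℕ) (v : C.I (j + 1) →₀ M) : C.proj M j (C.d M j v) = C.d M j v := by
  refine DFunLike.congr_fun (f := (C.proj M j).comp (C.d M j)) (g := C.d M j) ?_ v
  refine Finsupp.addHom_ext fun i m => ?_
  ext k
  rw [AddMonoidHom.comp_apply, proj_apply, d_single, smul_smul, ← MulOpposite.op_mul, C.right]

theorem d_proj (j : ℕ) (v : C.I (j + 1) →₀ M) : C.d M j (C.proj M (j + 1) v) = C.d M j v := by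
  refine DFunLike.congr_fun (f := (C.d M j).comp (C.proj M (j + 1))) (g := C.d M j) ?_ v
  refine Finsupp.addHom_ext fun i m => ?_
  ext k
  rw [AddMonoidHom.comp_apply, proj_single, d_single, d_single, smul_smul, ← MulOpposite.op_mul,
    C.left]

theorem d_d (j : ℕ) (v : C.I (j + 2) →₀ M) : C.d M j (C.d M (j + 1) v) = 0 :=
  rowMap_rowMap_eq_zero _ _ (C.comp j) v

/-- The chain map induced by a linear map of coefficients. -/
noncomputable def map (φ : M →ₗ[Lᵐᵒᵖ] M') (j : ℕ) : (C.I j →₀ M) →+ (C.I j →₀ M') :=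
  finsuppMap _ φ.toAddMonoidHom

@[simp]
theorem map_apply (φ : M →ₗ[Lᵐᵒᵖ] M') (j : ℕ) (v : C.I j →₀ M) (i : C.I j) :
    C.map φ j v i = φ (v i) := rfl

theorem map_d (φ : M →ₗ[Lᵐᵒᵖ] M') (j : ℕ) (v : C.I (j + 1) →₀ M) :
    C.map φ j (C.d M j v) = C.d M' j (C.map φ (j + 1) v) :=
  finsuppMap_rowMap _ _ _

theorem map_proj (φ : M →ₗ[Lᵐᵒᵖ] M') (j : ℕ) (v : C.I j →₀ M) :
    C.map φ j (C.proj M j v) = C.proj M' j (C.map φ j v) := by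
  ext i
  simp [proj_apply]

section LongExact

variable {K P N : Type u} [AddCommGroup K] [Module Lᵐᵒᵖ K] [AddCommGroup P] [Module Lᵐᵒᵖ P]
  [AddCommGroup N] [Module Lᵐᵒᵖ N] {ι : K →ₗ[Lᵐᵒᵖ] P} {π : P →ₗ[Lᵐᵒᵖ] N}

theorem map_injective (hι : Function.Injective ι) (j : ℕ) : Function.Injective (C.map ι j) :=
  finsuppMap_injective _ hι

theorem exists_map_eq_of_proj_eq (hπ : Function.Surjective π) (j : ℕ) (v : C.I j →₀ N)
    (hv : C.proj N j v = v) : ∃ y, C.proj P j y = y ∧ C.map π j y = v := by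
  obtain ⟨y, hy⟩ := finsuppMap_surjective (C.I j) (φ := π.toAddMonoidHom) hπ v
  refine ⟨C.proj P j y, C.proj_proj j y, ?_⟩
  rw [map_proj]
  change C.proj N j (finsuppMap _ π.toAddMonoidHom y) = v
  rw [hy, hv]

theorem exists_map_eq_of_map_eq_zero (hex : Function.Exact ι π) (j : ℕ) (y : C.I j →₀ P)
    (hy : C.map π j y = 0) : ∃ v, C.map ι j v = y :=
  exists_finsuppMap_eq _ y fun i => (hex (y i)).1 (by
    have := DFunLike.congr_fun hy i
    simpa using this)

theorem map_map_eq_zero (hex : Function.Exact ι π) (j : ℕ) (v : C.I j →₀ K) :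
    C.map π j (C.map ι j v) = 0 := by
  ext i
  simp [hex.apply_apply_eq_zero]

/-- The homology of the quotient vanishes if that of `P` does and the next homology of the kernel
injects into that of `P`. -/
theorem acyc_right (hι : Function.Injective ι) (hπ : Function.Surjective π)
    (hex : Function.Exact ι π) {j : ℕ} (hP : C.Acyc P j)
    (hK : ∀ v : C.I j →₀ K, C.proj K j v = v → (∃ w, C.d P j w = C.map ι j v) →
      ∃ w, C.d K j w = v) : C.Acyc N j := by
  intro v hv hdv
  obtain ⟨y, hy, rfl⟩ := C.exists_map_eq_of_proj_eq hπ _ v hv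
  rw [← map_d] at hdv
  obtain ⟨x, hx⟩ := C.exists_map_eq_of_map_eq_zero hex _ _ hdv
  obtain ⟨w, hw⟩ := hK x (C.map_injective hι _ (by rw [map_proj, hx, proj_d])) ⟨y, hx.symm⟩
  -- `w` need not be fixed by the idempotent; projecting it does not change its differential.
  have hcyc : C.d P j (y - C.map ι (j + 1) (C.proj K (j + 1) w)) = 0 := by
    rw [map_sub, ← map_d, d_proj, hw, hx, sub_self]
  obtain ⟨z, hz⟩ := hP _ (by rw [map_sub, hy, ← map_proj, proj_proj]) hcyc
  refine ⟨C.map π _ z, ?_⟩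
  rw [← map_d, hz, map_sub, map_map_eq_zero _ hex, sub_zero]

/-- If the homology of the kernel vanishes then that of `P` injects into that of the quotient. -/
theorem exists_d_eq_of_map_right (hι : Function.Injective ι) (hπ : Function.Surjective π)
    (hex : Function.Exact ι π) {j : ℕ} (hK : C.Acyc K j) (v : C.I (j + 1) →₀ P)
    (hv : C.proj P (j + 1) v = v) (hdv : C.d P j v = 0)
    (h : ∃ w, C.d N (j + 1) w = C.map π (j + 1) v) : ∃ w, C.d P (j + 1) w = v := by
  obtain ⟨w, hw⟩ := h
  obtain ⟨y, rfl⟩ := finsuppMap_surjective (C.I (j + 2)) (φ := π.toAddMonoidHom) hπ w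
  have hw' : C.map π (j + 1) (C.d P (j + 1) y) = C.map π (j + 1) v := by
    rw [map_d]
    exact hw
  obtain ⟨x, hx⟩ := C.exists_map_eq_of_map_eq_zero hex (j + 1) (v - C.d P (j + 1) y) (by
    rw [map_sub, hw', sub_self])
  obtain ⟨z, hz⟩ := hK x (C.map_injective hι _ (by rw [map_proj, hx, map_sub, proj_d, hv]))
    (C.map_injective hι _ (by rw [map_d, hx, map_sub, hdv, d_d, map_zero, sub_zero]))
  refine ⟨y + C.map ι _ z, ?_⟩
  rw [map_add, ← map_d, hz, hx, add_sub_cancel]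

/-- If the homology of the quotient vanishes then the next homology of the kernel injects into
that of `P`. -/
theorem exists_d_eq_of_map_left (hι : Function.Injective ι) (hπ : Function.Surjective π)
    (hex : Function.Exact ι π) {j : ℕ} (hN : C.Acyc N (j + 1)) (v : C.I (j + 1) →₀ K)
    (h : ∃ w, C.d P (j + 1) w = C.map ι (j + 1) v) : ∃ w, C.d K (j + 1) w = v := by
  obtain ⟨w, hw⟩ := h
  obtain ⟨u, hu⟩ := hN (C.map π _ (C.proj P _ w)) (by rw [← map_proj, proj_proj]) (by
    rw [← map_d, d_proj, hw, map_map_eq_zero _ hex])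
  obtain ⟨y, rfl⟩ := finsuppMap_surjective (C.I (j + 3)) (φ := π.toAddMonoidHom) hπ u
  have hu' : C.map π _ (C.d P (j + 2) y) = C.map π _ (C.proj P _ w) := by
    rw [map_d]
    exact hu
  obtain ⟨x, hx⟩ := C.exists_map_eq_of_map_eq_zero hex (j + 2)
    (C.proj P _ w - C.d P (j + 2) y) (by rw [map_sub, hu', sub_self])
  refine ⟨x, C.map_injective hι _ ?_⟩
  rw [map_d, hx, map_sub, d_d, sub_zero, d_proj, hw]

/-- The homology of the kernel vanishes if that of `P` and the next homology of the quotient do. -/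
theorem acyc_left (hι : Function.Injective ι) (hπ : Function.Surjective π)
    (hex : Function.Exact ι π) {j : ℕ} (hP : C.Acyc P j) (hN : C.Acyc N (j + 1)) :
    C.Acyc K j := fun v hv hdv =>
  C.exists_d_eq_of_map_left hι hπ hex hN v
    (hP _ (by rw [← map_proj, hv]) (by rw [← map_d, hdv, map_zero]))

end LongExact

end MatChain

end Matrices

/-! ### The complex of left modules attached to a pair of idempotents -/

section Resolution

variable {R : Type u} [Ring R]

/-- The right ideal `gR = {x | g x = x}` of an idempotent `g`. -/
def fixedRightIdeal (g : R) : Submodule Rᵐᵒᵖ R where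
  carrier := {x | g * x = x}
  add_mem' {x y} hx hy := by
    change g * (x + y) = x + y
    rw [mul_add, hx, hy]
  zero_mem' := mul_zero g
  smul_mem' r x hx := by
    change g * (x * r.unop) = x * r.unop
    rw [← mul_assoc, hx]

theorem mem_fixedRightIdeal {g x : R} : x ∈ fixedRightIdeal g ↔ g * x = x := Iff.rfl

/-- Left multiplication by `x` as a right linear map `R → gR` if `g x = x`. -/
def toFixedRightIdeal (g x : R) (h : g * x = x) : R →ₗ[Rᵐᵒᵖ] fixedRightIdeal g where
  toFun r := ⟨x * r, by rw [mem_fixedRightIdeal, ← mul_assoc, h]⟩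
  map_add' r s := Subtype.ext (mul_add x r s)
  map_smul' s r := Subtype.ext (mul_assoc x r s.unop).symm

/-- One matrix of a `MatChain` together with the two idempotents. -/
structure MatStage (R : Type u) [Ring R] where
  /-- the target index set -/
  tgt : Type u
  /-- the source index set -/
  src : Type u
  /-- the target idempotent -/
  h' : R
  /-- the source idempotent -/
  h : R
  /-- the matrix -/
  a : src → (tgt →₀ R)
  idem' : IsIdempotentElem h'
  idem : IsIdempotentElem h
  left : ∀ i k, h * a i k = a i k
  right : ∀ i k, a i k * h' = a i k

/-- Cover the `f`-part of the cycles by copies of `Rf`. -/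
def MatStage.next {f : R} (hf : IsIdempotentElem f) (s : MatStage R) : MatStage R where
  tgt := s.src
  src := {q : s.src →₀ R // (∀ i, f * q i = q i) ∧ (∀ i, q i * s.h = q i) ∧ rowMap s.a R q = 0}
  h' := s.h
  h := f
  a := Subtype.val
  idem' := s.idem
  idem := hf
  left i k := i.2.1 k
  right i k := i.2.2.1 k

/-- The initial stage `Re → 0`. -/
def MatStage.init {e : R} (he : IsIdempotentElem e) : MatStage R where
  tgt := PEmpty
  src := PUnit
  h' := 1
  h := e
  a := 0
  idem' := mul_one 1
  idem := he
  left _ k := k.elim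
  right _ k := k.elim

/-- The stages of `peirceChain`. -/
def peirceStage {e f : R} (he : IsIdempotentElem e) (hf : IsIdempotentElem f) : ℕ → MatStage R
  | 0 => MatStage.init he
  | j + 1 => (peirceStage he hf j).next hf

/-- A complex `⋯ → (Rf)^{(I₃)} → (Rf)^{(I₂)} → Re → 0` of projective left modules whose homology
is annihilated by `f`. -/
def peirceChain {e f : R} (he : IsIdempotentElem e) (hf : IsIdempotentElem f) : MatChain R where
  I j := (peirceStage he hf j).tgt
  h j := (peirceStage he hf j).h'
  a j := (peirceStage he hf j).a
  idem j := (peirceStage he hf j).idem'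
  left j := (peirceStage he hf j).left
  right j := (peirceStage he hf j).right
  comp _ i := i.2.2.2

variable {e f : R} (he : IsIdempotentElem e) (hf : IsIdempotentElem f)

theorem peirceChain_h_one : (peirceChain he hf).h 1 = e := rfl

theorem peirceChain_h (j : ℕ) : (peirceChain he hf).h (j + 2) = f := rfl

/-- The next index set consists of all such `q`, so `q` is the row indexed by itself. -/
theorem peirceChain_exact (j : ℕ) (q : (peirceChain he hf).I (j + 1) →₀ R)
    (hfq : ∀ i, f * q i = q i) (hq : (peirceChain he hf).proj R (j + 1) q = q)
    (hd : (peirceChain he hf).d R j q = 0) :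
    ∃ w, (peirceChain he hf).d R (j + 1) w = q := by
  have h2 : ∀ i, q i * (peirceChain he hf).h (j + 1) = q i := fun i => DFunLike.congr_fun hq i
  exact ⟨Finsupp.single (⟨q, hfq, h2, hd⟩ : (peirceStage he hf (j + 1)).src) 1,
    rowMap_single_one _ _⟩

/-- Tensoring with `fR` takes the `f`-part of the complex, which is exact by construction. A
preimage found over `R` is brought back into `fR` by left multiplication by `f`, which fixes the
given cycle. -/
theorem acyc_fixedRightIdeal (j : ℕ) : (peirceChain he hf).Acyc (fixedRightIdeal f) j := by
  intro v hv hdv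
  have hval : ∀ (i) (v : (peirceChain he hf).I i →₀ fixedRightIdeal f),
      (peirceChain he hf).map (toFixedRightIdeal f f hf) i
        ((peirceChain he hf).map (fixedRightIdeal f).subtype i v) = v := by
    intro i v
    ext k
    exact (v k).2
  obtain ⟨w, hw⟩ := peirceChain_exact he hf j ((peirceChain he hf).map (Submodule.subtype _) _ v)
    (fun i => (v i).2) (by rw [← MatChain.map_proj, hv]) (by
      rw [← MatChain.map_d, hdv, map_zero])
  refine ⟨(peirceChain he hf).map (toFixedRightIdeal f f hf) _ w, ?_⟩
  rw [← MatChain.map_d, hw, hval]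

/-- From index 2 on the terms are sums of copies of `Mf = 0`. -/
theorem acyc_of_smul_eq_zero {M : Type u} [AddCommGroup M] [Module Rᵐᵒᵖ M]
    (hM : ∀ m : M, MulOpposite.op f • m = 0) (j : ℕ) :
    (peirceChain he hf).Acyc M (j + 1) := by
  intro v hv _
  refine ⟨0, ?_⟩
  rw [map_zero, ← hv]
  ext i
  exact (hM _).symm

/-- The generator `e` of the degree-zero term is a cycle, whereas boundaries have entries in `eRfR`,
hence in the radical. -/
theorem not_acyc_zero (hJ : ∀ r, e * r * f ∈ Ring.jacobson R) (hne : e ∉ Ring.jacobson R) :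
    ¬ (peirceChain he hf).Acyc (fixedRightIdeal e) 0 := by
  intro h
  let o : (peirceChain he hf).I (0 + 1) := PUnit.unit
  obtain ⟨w, hw⟩ := h (Finsupp.single o ⟨e, he⟩) (by
      rw [MatChain.proj_single]
      exact congrArg _ (Subtype.ext he)) (by
      ext k
      exact k.elim)
  have hmem : ∀ w : (peirceChain he hf).I 2 →₀ fixedRightIdeal e, ∀ k,
      ((peirceChain he hf).d (fixedRightIdeal e) 1 w k : R) ∈ Ring.jacobson R := by
    intro w k
    induction w using Finsupp.induction_linear with
    | zero => simp
    | add x y hx hy =>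
      rw [map_add, Finsupp.add_apply, Submodule.coe_add]
      exact add_mem hx hy
    | single i m =>
      rw [MatChain.d_single]
      change m.1 * (peirceChain he hf).a 1 i k ∈ _
      rw [← (peirceChain he hf).left, peirceChain_h, ← mul_assoc, ← m.2]
      exact Ideal.mul_mem_right _ _ (hJ _)
  apply hne
  have hmem' := hmem w o
  rwa [hw, Finsupp.single_eq_same] at hmem'

end Resolution

/-! ### Restriction to the corner ring -/

section Corner

variable {R : Type u} [Ring R] {e f : R} (he : IsIdempotentElem e) (hf : IsIdempotentElem f)

/-- The inclusion of the corner ring. -/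
def cornerVal : hf.Corner →+ R where
  toFun x := x.1
  map_zero' := rfl
  map_add' _ _ := rfl

theorem cornerVal_injective : Function.Injective (cornerVal hf) := Subtype.val_injective

theorem exists_finsupp_cornerVal {I : Type u} (v : I →₀ R) (h1 : ∀ i, f * v i = v i)
    (h2 : ∀ i, v i * f = v i) : ∃ w : I →₀ hf.Corner, finsuppMap I (cornerVal hf) w = v :=
  exists_finsuppMap_eq _ v fun i =>
    ⟨⟨v i, (Subsemigroup.mem_corner_iff hf).2 ⟨h1 i, h2 i⟩⟩, rfl⟩

/-- The rows of `peirceChain` over the corner ring. -/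
noncomputable def cornerRow (j : ℕ) (i : (peirceChain he hf).I (j + 3)) :
    (peirceChain he hf).I (j + 2) →₀ hf.Corner :=
  (exists_finsupp_cornerVal hf ((peirceChain he hf).a (j + 2) i)
    ((peirceChain he hf).left (j + 2) i) ((peirceChain he hf).right (j + 2) i)).choose

theorem cornerRow_spec (j : ℕ) (i : (peirceChain he hf).I (j + 3)) :
    finsuppMap _ (cornerVal hf) (cornerRow he hf j i) = (peirceChain he hf).a (j + 2) i :=
  (exists_finsupp_cornerVal hf ((peirceChain he hf).a (j + 2) i)
    ((peirceChain he hf).left (j + 2) i) ((peirceChain he hf).right (j + 2) i)).choose_spec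

theorem cornerRow_apply (j : ℕ) (i : (peirceChain he hf).I (j + 3)) (k) :
    (cornerRow he hf j i k).1 = (peirceChain he hf).a (j + 2) i k :=
  DFunLike.congr_fun (cornerRow_spec he hf j i) k

/-- An additive map from an `fRf`-module to an `R`-module compatible with the actions commutes
with the differentials. -/
theorem finsuppMap_rowMap_cornerRow {N M : Type u} [AddCommGroup N] [Module (hf.Corner)ᵐᵒᵖ N]
    [AddCommGroup M] [Module Rᵐᵒᵖ M] (κ : N →+ M)
    (hκ : ∀ (n : N) (g : hf.Corner), κ (MulOpposite.op g • n) = MulOpposite.op g.1 • κ n)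
    (j : ℕ) (v : (peirceChain he hf).I (j + 3) →₀ N) :
    finsuppMap _ κ (rowMap (cornerRow he hf j) N v) =
      (peirceChain he hf).d M (j + 2) (finsuppMap _ κ v) := by
  refine DFunLike.congr_fun (f := (finsuppMap _ κ).comp (rowMap (cornerRow he hf j) N))
    (g := ((peirceChain he hf).d M (j + 2)).comp (finsuppMap _ κ)) ?_ v
  refine Finsupp.addHom_ext fun i m => ?_
  ext k
  rw [AddMonoidHom.comp_apply, AddMonoidHom.comp_apply, finsuppMap_single, MatChain.d_single,
    finsuppMap_apply, rowMap_single, hκ, cornerRow_apply]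

/-- The part of `peirceChain` in degrees at least two, as a complex of free modules over the
corner ring. -/
noncomputable def cornerChain : MatChain hf.Corner where
  I j := (peirceChain he hf).I (j + 2)
  h _ := 1
  a j := cornerRow he hf j
  idem _ := mul_one 1
  left _ _ _ := one_mul _
  right _ _ _ := mul_one _
  comp j i := by
    apply finsuppMap_injective _ (cornerVal_injective hf)
    rw [finsuppMap_rowMap_cornerRow he hf (M := R) (cornerVal hf) (fun _ _ => rfl),
      cornerRow_spec, map_zero]
    exact (peirceChain he hf).comp (j + 2) i

/-- Exactness over the corner ring implies exactness over `R`. -/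
theorem acyc_of_acyc_cornerChain {N M : Type u} [AddCommGroup N] [Module (hf.Corner)ᵐᵒᵖ N]
    [AddCommGroup M] [Module Rᵐᵒᵖ M] (κ : N →+ M)
    (hκ : ∀ (n : N) (g : hf.Corner), κ (MulOpposite.op g • n) = MulOpposite.op g.1 • κ n)
    (hinj : Function.Injective κ) (hrange : ∀ m, MulOpposite.op f • m = m → ∃ n, κ n = m)
    {j : ℕ} (h : (cornerChain he hf).Acyc N j) : (peirceChain he hf).Acyc M (j + 2) := by
  intro v hv hdv
  obtain ⟨y, rfl⟩ := exists_finsuppMap_eq κ v fun i => hrange _ (DFunLike.congr_fun hv i)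
  obtain ⟨w, hw⟩ := h y (by ext; exact one_smul _ _) (by
    apply finsuppMap_injective _ hinj
    exact ((finsuppMap_rowMap_cornerRow he hf κ hκ j y).trans hdv).trans (map_zero _).symm)
  refine ⟨finsuppMap _ κ w, ?_⟩
  rw [← hw]
  exact (finsuppMap_rowMap_cornerRow he hf κ hκ (j + 1) w).symm

/-- A preimage over `R` is compressed to `fRf` by multiplying by `f` on both sides. For `j = 0` this
is exactness at the start of the resolution of `fRe`. -/
theorem exists_rowMap_cornerRow_eq (j : ℕ) (v : (peirceChain he hf).I (j + 2) →₀ hf.Corner)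
    (hdv : (peirceChain he hf).d R (j + 1) (finsuppMap _ (cornerVal hf) v) = 0) :
    ∃ w, rowMap (cornerRow he hf j) hf.Corner w = v := by
  have hmem : ∀ x : hf.Corner, f * x.1 = x.1 ∧ x.1 * f = x.1 := fun x =>
    (Subsemigroup.mem_corner_iff hf).1 x.2
  obtain ⟨w, hw⟩ := peirceChain_exact he hf (j + 1) (finsuppMap _ (cornerVal hf) v)
    (fun i => (hmem (v i)).1) (by ext i; exact (hmem (v i)).2) hdv
  obtain ⟨w', hw'⟩ := exists_finsupp_cornerVal hf
    ((peirceChain he hf).map ((fixedRightIdeal f).subtype.comp (toFixedRightIdeal f f hf)) _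
      ((peirceChain he hf).proj R _ w))
    (fun i => by
      change f * (f * (w i * f)) = f * (w i * f)
      rw [← mul_assoc, hf.eq])
    (fun i => by
      change f * (w i * f) * f = f * (w i * f)
      rw [mul_assoc, mul_assoc, hf.eq])
  refine ⟨w', finsuppMap_injective _ (cornerVal_injective hf) ?_⟩
  rw [finsuppMap_rowMap_cornerRow he hf (M := R) (cornerVal hf) (fun _ _ => rfl),
    hw', ← MatChain.map_d, MatChain.d_proj, hw]
  ext i
  exact (hmem (v i)).1

theorem acyc_cornerChain_corner (j : ℕ) : (cornerChain he hf).Acyc hf.Corner j := fun v _ hdv =>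
  exists_rowMap_cornerRow_eq he hf (j + 1) v
    ((finsuppMap_rowMap_cornerRow he hf (M := R) (cornerVal hf) (fun _ _ => rfl) j v).symm.trans
      ((congrArg _ hdv).trans (map_zero _)))

end Corner

/-! ### Balancing: `Tor` computed by a resolution of the left module -/

section Balance

variable {L : Type u} [Ring L]

/-- The map `L^{(I)} → X`, `q ↦ ∑ q_i x_i`. -/
noncomputable def leftEval {I X : Type u} [AddCommGroup X] [Module L X] (x : I → X) :
    (I →₀ L) →+ X :=
  Finsupp.liftAddHom fun i => (AddMonoidHom.flip (smulAddHom L X)) (x i)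

theorem leftEval_single {I X : Type u} [AddCommGroup X] [Module L X] (x : I → X) (i : I) (r : L) :
    leftEval x (Finsupp.single i r) = r • x i := by
  simp [leftEval]

/-- Pure tensors, as a biadditive map. -/
def ncTmul (L : Type u) [Ring L] (N X : Type u) [AddCommGroup N] [Module Lᵐᵒᵖ N] [AddCommGroup X]
    [Module L X] : N →+ X →+ NCTensor L N X where
  toFun n :=
    { toFun := fun y => QuotientAddGroup.mk (n ⊗ₜ[ℤ] y)
      map_zero' := congrArg QuotientAddGroup.mk (TensorProduct.tmul_zero X n)
      map_add' := fun y z => congrArg QuotientAddGroup.mk (TensorProduct.tmul_add n y z) }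
  map_zero' := AddMonoidHom.ext fun y =>
    congrArg QuotientAddGroup.mk (TensorProduct.zero_tmul N y)
  map_add' m n := AddMonoidHom.ext fun y =>
    congrArg QuotientAddGroup.mk (TensorProduct.add_tmul m n y)

variable {X : Type u} [AddCommGroup X] [Module L X]

theorem ncTmul_smul {N : Type u} [AddCommGroup N] [Module Lᵐᵒᵖ N] (n : N) (r : L) (y : X) :
    ncTmul L N X (MulOpposite.op r • n) y = ncTmul L N X n (r • y) := by
  refine QuotientAddGroup.eq.2 (AddSubgroup.subset_closure ⟨-n, r, y, ?_⟩)
  rw [smul_neg, TensorProduct.neg_tmul, TensorProduct.neg_tmul, sub_neg_eq_add]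

/-- Balanced biadditive maps factor through the tensor product. -/
theorem exists_ncTensor_lift {N Q : Type u} [AddCommGroup N] [Module Lᵐᵒᵖ N] [AddCommGroup Q]
    (σ : N →+ X →+ Q)
    (hσ : ∀ (n : N) (r : L) (y : X), σ (MulOpposite.op r • n) y = σ n (r • y)) :
    ∃ ρ : NCTensor L N X →+ Q, ∀ n y, ρ (ncTmul L N X n y) = σ n y := by
  let τ : N ⊗[ℤ] X →+ Q := TensorProduct.liftAddHom σ (fun r m y => by
    rw [map_zsmul, map_zsmul, AddMonoidHom.zsmul_apply])
  have hrel : ncTensorRel L N X ≤ τ.ker := by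
    refine (AddSubgroup.closure_le _).2 ?_
    rintro _ ⟨n, r, y, rfl⟩
    change τ _ = 0
    rw [map_sub, sub_eq_zero]
    exact hσ n r y
  exact ⟨QuotientAddGroup.lift _ τ hrel, fun n y => rfl⟩

theorem ncTmul_induction {N : Type u} [AddCommGroup N] [Module Lᵐᵒᵖ N]
    {p : NCTensor L N X → Prop} (t : NCTensor L N X) (zero : p 0)
    (tmul : ∀ n y, p (ncTmul L N X n y)) (add : ∀ a b, p a → p b → p (a + b)) : p t := by
  obtain ⟨t, rfl⟩ := QuotientAddGroup.mk_surjective t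
  induction t using TensorProduct.induction_on with
  | zero => exact zero
  | tmul n y => exact tmul n y
  | add a b ha hb => exact add _ _ ha hb

/-- The map `N^{(I)} → N ⊗ X`, `v ↦ ∑ v_i ⊗ x_i`. -/
noncomputable def tensorEval (L : Type u) [Ring L] {I X : Type u} [AddCommGroup X] [Module L X]
    (x : I → X) (N : Type u) [AddCommGroup N] [Module Lᵐᵒᵖ N] : (I →₀ N) →+ NCTensor L N X :=
  Finsupp.liftAddHom fun i => (ncTmul L N X).flip (x i)

theorem tensorEval_single {I : Type u} (x : I → X) {N : Type u} [AddCommGroup N] [Module Lᵐᵒᵖ N]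
    (i : I) (n : N) : tensorEval L x N (Finsupp.single i n) = ncTmul L N X n (x i) := by
  rw [tensorEval, Finsupp.liftAddHom_apply_single, AddMonoidHom.flip_apply]

theorem tensorEval_orbitMap {I : Type u} (x : I → X) {N : Type u} [AddCommGroup N]
    [Module Lᵐᵒᵖ N] (n : N) (q : I →₀ L) :
    tensorEval L x N (finsuppMap I (orbitMap n).toAddMonoidHom q) =
      ncTmul L N X n (leftEval x q) := by
  induction q using Finsupp.induction_linear with
  | zero => rw [map_zero, map_zero, map_zero, map_zero]
  | add a b ha hb => rw [map_add, map_add, map_add, map_add, ha, hb]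
  | single i r =>
    rw [finsuppMap_single, leftEval_single, tensorEval_single]
    exact ncTmul_smul n r (x i)

theorem ncTensorMap_tensorEval {I : Type u} (x : I → X) {N N' : Type u} [AddCommGroup N]
    [Module Lᵐᵒᵖ N] [AddCommGroup N'] [Module Lᵐᵒᵖ N'] (φ : N →ₗ[Lᵐᵒᵖ] N') (v : I →₀ N) :
    ncTensorMap L X φ (tensorEval L x N v) =
      tensorEval L x N' (finsuppMap I φ.toAddMonoidHom v) := by
  induction v using Finsupp.induction_linear with
  | zero => simp only [map_zero]
  | add a b ha hb => simp only [map_add, ha, hb]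
  | single i n =>
    rw [finsuppMap_single, tensorEval_single, tensorEval_single]
    rfl

theorem tensorEval_surjective {I : Type u} (x : I → X)
    (hx : Function.Surjective (leftEval (L := L) x)) (N : Type u) [AddCommGroup N]
    [Module Lᵐᵒᵖ N] : Function.Surjective (tensorEval L x N) := by
  intro t
  induction t using ncTmul_induction with
  | zero => exact ⟨0, map_zero _⟩
  | tmul n y =>
    obtain ⟨q, rfl⟩ := hx y
    exact ⟨_, tensorEval_orbitMap x n q⟩
  | add a b ha hb =>
    obtain ⟨v, hv⟩ := ha
    obtain ⟨w, hw⟩ := hb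
    exact ⟨v + w, by rw [map_add, hv, hw]⟩

/-- An additive map out of the target of a surjection, given on the source. -/
theorem exists_hom_of_ker_le {A B Q : Type u} [AddCommGroup A] [AddCommGroup B] [AddCommGroup Q]
    (p : A →+ B) (hp : Function.Surjective p) (g : A →+ Q) (h : ∀ a, p a = 0 → g a = 0) :
    ∃ σ : B →+ Q, ∀ a, σ (p a) = g a := by
  refine ⟨(QuotientAddGroup.lift p.ker g h).comp
    (QuotientAddGroup.quotientKerEquivOfSurjective p hp).symm.toAddMonoidHom, fun a => ?_⟩
  have h1 : (QuotientAddGroup.quotientKerEquivOfSurjective p hp).symm (p a) =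
      QuotientAddGroup.mk a := by
    rw [AddEquiv.symm_apply_eq]
    rfl
  exact congrArg (QuotientAddGroup.lift p.ker g h) h1

theorem smul_leftEval {I : Type u} (x : I → X) (r : L) (q : I →₀ L) :
    r • leftEval x q = leftEval x (finsuppMap I (AddMonoidHom.mulLeft r) q) := by
  induction q using Finsupp.induction_linear with
  | zero => simp only [map_zero, smul_zero]
  | add a b ha hb => simp only [map_add, smul_add, ha, hb]
  | single i s =>
    rw [finsuppMap_single, leftEval_single, leftEval_single]
    exact smul_smul _ _ _

/-- Right exactness of the tensor product. -/
theorem exists_rowMap_eq_of_tensorEval_eq_zero {I' I : Type u} (a : I' → (I →₀ L)) (x : I → X)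
    (hx : Function.Surjective (leftEval (L := L) x))
    (hex : ∀ q : I →₀ L, leftEval x q = 0 → ∃ w, rowMap a L w = q)
    {N : Type u} [AddCommGroup N] [Module Lᵐᵒᵖ N] (v : I →₀ N) (hv : tensorEval L x N v = 0) :
    ∃ w, rowMap a N w = v := by
  -- The rule `n ⊗ ∑ q_i x_i ↦ [(n q_i)_i]` is well defined modulo the image of the matrix, and
  -- composing it with `tensorEval` gives the quotient map.
  let g : (I →₀ N) →+ (I →₀ N) ⧸ (rowMap a N).range := QuotientAddGroup.mk' _
  have hg : ∀ w, g w = 0 ↔ ∃ u, rowMap a N u = w := fun w => QuotientAddGroup.eq_zero_iff w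
  have h1 : ∀ n : N, ∃ σ : X →+ (I →₀ N) ⧸ (rowMap a N).range, ∀ q, σ (leftEval x q) =
      (g.comp (finsuppMap I (orbitMap (L := L) n).toAddMonoidHom)) q := by
    intro n
    refine exists_hom_of_ker_le _ hx _ fun q hq => ?_
    obtain ⟨w, rfl⟩ := hex q hq
    exact (hg _).2 ⟨_, (finsuppMap_rowMap a (orbitMap n) w).symm⟩
  choose σ hσ using h1
  let σ' : N →+ X →+ (I →₀ N) ⧸ (rowMap a N).range := AddMonoidHom.mk' σ (fun m n => by
    refine AddMonoidHom.ext fun y => ?_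
    obtain ⟨q, rfl⟩ := hx y
    rw [AddMonoidHom.add_apply, hσ, hσ, hσ, AddMonoidHom.comp_apply, AddMonoidHom.comp_apply,
      AddMonoidHom.comp_apply, ← map_add]
    congr 1
    ext i
    exact smul_add _ _ _)
  obtain ⟨ρ, hρ⟩ := exists_ncTensor_lift (L := L) σ' (fun n r y => by
    obtain ⟨q, rfl⟩ := hx y
    rw [smul_leftEval]
    refine ((hσ _ _).trans ?_).trans (hσ _ _).symm
    rw [AddMonoidHom.comp_apply, AddMonoidHom.comp_apply]
    congr 1
    ext i
    exact smul_smul _ _ _)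
  have hρ' : ∀ v, ρ (tensorEval L x N v) = g v := by
    intro v
    induction v using Finsupp.induction_linear with
    | zero => simp only [map_zero]
    | add b c hb hc => simp only [map_add, hb, hc]
    | single i n =>
      rw [tensorEval_single, hρ]
      have h2 : x i = leftEval x (Finsupp.single i (1 : L)) := by rw [leftEval_single, one_smul]
      rw [h2]
      refine (hσ n _).trans ?_
      rw [AddMonoidHom.comp_apply, finsuppMap_single]
      exact congrArg (fun z => g (Finsupp.single i z)) (one_smul _ n)
  exact (hg v).1 (by rw [← hρ', hv, map_zero])

namespace MatChain

variable (C : MatChain L)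

/-- The identity of `E` is a pointwise finite sum of maps through the `P y`, and a chain has finite
support, so boundaries found in finitely many `P y` can be added up. This serves both projective
modules, through a dual basis, and finite products. -/
theorem acyc_of_dualBasis {Y : Type u} {E : Type u} [AddCommGroup E] [Module Lᵐᵒᵖ E]
    (P : Y → Type u) [∀ y, AddCommGroup (P y)] [∀ y, Module Lᵐᵒᵖ (P y)]
    (φ : ∀ y, E →ₗ[Lᵐᵒᵖ] P y) (ψ : ∀ y, P y →ₗ[Lᵐᵒᵖ] E)
    (h : ∀ m, ∃ F : Finset Y, ∀ F', F ⊆ F' → ∑ y ∈ F', ψ y (φ y m) = m) {j : ℕ}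
    (hP : ∀ y, C.Acyc (P y) j) : C.Acyc E j := by
  classical
  intro v hv hdv
  choose F hF using h
  have hw : ∀ y, ∃ w, C.d (P y) (j + 1) w = C.map (φ y) _ v := fun y =>
    hP y _ (by rw [← map_proj, hv]) (by rw [← map_d, hdv, map_zero])
  choose w hw using hw
  refine ⟨∑ y ∈ v.support.biUnion (fun i => F (v i)), C.map (ψ y) _ (w y), ?_⟩
  rw [map_sum]
  simp only [← map_d, hw]
  ext i
  rw [Finsupp.finsetSum_apply]
  simp only [map_apply]
  by_cases hi : i ∈ v.support
  · exact hF _ _ (Finset.subset_biUnion_of_mem (fun i => F (v i)) hi)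
  · rw [Finsupp.notMem_support_iff.1 hi]
    simp

theorem acyc_of_projective {E : Type u} [AddCommGroup E] [Module Lᵐᵒᵖ E]
    (hE : Module.Projective Lᵐᵒᵖ E) {j : ℕ} (hL : C.Acyc L j) : C.Acyc E j := by
  obtain ⟨s, hs⟩ := Module.projective_def.1 hE
  let unopMap : Lᵐᵒᵖ →ₗ[Lᵐᵒᵖ] L :=
    { toFun := MulOpposite.unop
      map_add' := fun _ _ => rfl
      map_smul' := fun _ _ => rfl }
  refine C.acyc_of_dualBasis (Y := E) (fun _ => L)
    (fun y => unopMap.comp ((Finsupp.lapply y).comp s)) (fun y => orbitMap y)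
    (fun m => ⟨(s m).support, fun F' hF' => ?_⟩) (fun _ => hL)
  have h1 := hs m
  rw [Finsupp.linearCombination_apply, Finsupp.sum_of_support_subset _ hF' _ (by simp)] at h1
  exact h1

/-- Dimension shifting along a projective resolution of the right module. -/
theorem acyc_of_tensor_exact (x : C.I 0 → X) (hx : Function.Surjective (leftEval (L := L) x))
    (hproj : ∀ j, C.h j = 1)
    (hex : ∀ q : C.I 0 →₀ L, leftEval x q = 0 → ∃ w, C.d L 0 w = q)
    (hcomp : ∀ i, leftEval x (C.a 0 i) = 0) (hL : ∀ j, C.Acyc L j) (j : ℕ) :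
    ∀ {N : Type u} [AddCommGroup N] [Module Lᵐᵒᵖ N] (E : ℕ → Type u)
      [∀ i, AddCommGroup (E i)] [∀ i, Module Lᵐᵒᵖ (E i)]
      (_ : ∀ i, Module.Projective Lᵐᵒᵖ (E i)) (δ : ∀ i, E (i + 1) →ₗ[Lᵐᵒᵖ] E i)
      (ε : E 0 →ₗ[Lᵐᵒᵖ] N) (_ : Function.Surjective ε) (_ : Function.Exact (δ 0) ε)
      (_ : ∀ i, Function.Exact (δ (i + 1)) (δ i))
      (_ : ∀ t, ncTensorMap L X (δ j) t = 0 → ∃ s, ncTensorMap L X (δ (j + 1)) s = t),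
      C.Acyc N j := by
  have hp : ∀ {N : Type u} [AddCommGroup N] [Module Lᵐᵒᵖ N] (j) (v : C.I j →₀ N),
      C.proj N j v = v := by
    intro N _ _ j v
    ext i
    rw [proj_apply, hproj, MulOpposite.op_one, one_smul]
  have hcomp' : ∀ {N : Type u} [AddCommGroup N] [Module Lᵐᵒᵖ N] (w),
      tensorEval L x N (C.d N 0 w) = 0 := by
    intro N _ _ w
    refine DFunLike.congr_fun (f := (tensorEval L x N).comp (C.d N 0)) (g := 0) ?_ w
    refine Finsupp.addHom_ext fun i n => ?_
    rw [AddMonoidHom.comp_apply, MatChain.d, rowMap_single_eq, tensorEval_orbitMap, hcomp,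
      map_zero]
    rfl
  induction j with
  | zero =>
    intro N _ _ E _ _ hE δ ε hε h0 h1 ht
    refine C.acyc_right (K := LinearMap.range (δ 0)) (ι := Submodule.subtype _) (π := ε)
      Subtype.val_injective hε ?_ (C.acyc_of_projective (hE 0) (hL 0)) ?_
    · rw [LinearMap.exact_iff, Submodule.range_subtype]
      exact LinearMap.exact_iff.1 h0
    · rintro v - ⟨w, hw⟩
      obtain ⟨y, rfl⟩ := finsuppMap_surjective (C.I 0)
        (φ := (δ 0).rangeRestrict.toAddMonoidHom) (δ 0).surjective_rangeRestrict v
      have hy : ncTensorMap L X (δ 0) (tensorEval L x _ y) = 0 := by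
        rw [ncTensorMap_tensorEval]
        have : finsuppMap (C.I 0) (δ 0).toAddMonoidHom y = C.d (E 0) 0 w := by
          rw [hw]
          ext i
          rfl
        rw [this, hcomp']
      -- The class of `y` in `E 1 ⊗ X` comes from `E 2 ⊗ X`. Subtracting a lift of that element
      -- leaves a boundary, and the correction disappears in the first syzygy because `δ 0 ∘ δ 1 =
      -- 0`.
      obtain ⟨t, ht⟩ := ht _ hy
      obtain ⟨s, rfl⟩ := tensorEval_surjective x hx _ t
      obtain ⟨u, hu⟩ := exists_rowMap_eq_of_tensorEval_eq_zero (C.a 0) x hx hex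
        (y - C.map (δ 1) 0 s) (by
          rw [map_sub, ← ht, ncTensorMap_tensorEval]
          exact sub_self _)
      refine ⟨C.map (δ 0).rangeRestrict 1 u, ?_⟩
      rw [← map_d]
      change C.map _ 0 (rowMap (C.a 0) _ u) = C.map (δ 0).rangeRestrict 0 y
      rw [hu, map_sub, sub_eq_self]
      ext i
      exact congrArg Subtype.val (Subtype.ext ((h1 0).apply_apply_eq_zero (s i)) :
        (δ 0).rangeRestrict (δ 1 (s i)) = 0)
  | succ j ih =>
    intro N _ _ E _ _ hE δ ε hε h0 h1 ht
    refine C.acyc_right (K := LinearMap.range (δ 0)) (ι := Submodule.subtype _) (π := ε)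
      Subtype.val_injective hε ?_ (C.acyc_of_projective (hE 0) (hL _)) ?_
    · rw [LinearMap.exact_iff, Submodule.range_subtype]
      exact LinearMap.exact_iff.1 h0
    · rintro v - ⟨w, hw⟩
      -- The truncated resolution resolves the first syzygy of `N`, which lowers the Tor degree by
      -- one.
      refine ih (fun i => E (i + 1)) (fun i => hE _) (fun i => δ (i + 1)) (δ 0).rangeRestrict
        (δ 0).surjective_rangeRestrict ?_ (fun i => h1 _) ht v (hp _ _) ?_
      · rw [LinearMap.exact_iff, LinearMap.ker_rangeRestrict]
        exact LinearMap.exact_iff.1 (h1 0)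
      · refine C.map_injective (ι := Submodule.subtype _) Subtype.val_injective _ ?_
        rw [map_d, ← hw, d_d, map_zero]

theorem acyc_of_subsingleton_tor (x : C.I 0 → X)
    (hx : Function.Surjective (leftEval (L := L) x)) (hproj : ∀ j, C.h j = 1)
    (hex : ∀ q : C.I 0 →₀ L, leftEval x q = 0 → ∃ w, C.d L 0 w = q)
    (hcomp : ∀ i, leftEval x (C.a 0 i) = 0) (hL : ∀ j, C.Acyc L j) (N : Type u) [AddCommGroup N]
    [Module Lᵐᵒᵖ N] (j : ℕ) (htor : Subsingleton (NCTor L (j + 1) N X)) : C.Acyc N j := by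
  let P := projectiveResolution (ModuleCat.of Lᵐᵒᵖ N)
  let ε : P.complex.X 0 ⟶ ModuleCat.of Lᵐᵒᵖ N := P.π.f 0
  have hepi : Epi ε := inferInstanceAs (Epi (P.π.f 0))
  refine C.acyc_of_tensor_exact x hx hproj hex hcomp hL j (fun i => P.complex.X i) (fun i => ?_)
    (fun i => (P.complex.d (i + 1) i).hom) ε.hom ((ModuleCat.epi_iff_surjective _).1 hepi) ?_ ?_ ?_
  · exact (IsProjective.iff_projective _).2 (P.projective i)
  · have h := (ShortComplex.moduleCat_exact_iff _).1 P.exact₀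
    refine fun y => ⟨fun hy => h y hy, ?_⟩
    rintro ⟨z, rfl⟩
    exact ConcreteCategory.congr_hom P.complex_d_comp_π_f_zero z
  · intro i
    have h := (ShortComplex.moduleCat_exact_iff _).1
      ((HomologicalComplex.exactAt_iff' _ (i + 2) (i + 1) i (by simp) (by simp)).1
        (P.complex_exactAt_succ i))
    refine fun y => ⟨fun hy => h y hy, ?_⟩
    rintro ⟨z, rfl⟩
    exact ConcreteCategory.congr_hom (P.complex.d_comp_d (i + 2) (i + 1) i) z
  · have h1 : Limits.IsZero (NCTor L (j + 1) N X) := AddCommGrpCat.isZero_of_subsingleton _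
    have h2 := (HomologicalComplex.exactAt_iff_isZero_homology _ _).2
      (h1.of_iso (P.isoLeftDerivedObj (ncTensorFunctor L X) (j + 1)).symm)
    exact (ShortComplex.ab_exact_iff _).1
      ((HomologicalComplex.exactAt_iff' _ (j + 2) (j + 1) j (by simp) (by simp)).1 h2)

end MatChain

end Balance

/-! ### `Tor` over the corner ring and exactness with coefficients in `eR` -/

section CornerTor

variable {R : Type u} [Ring R] {e f : R} (he : IsIdempotentElem e) (hf : IsIdempotentElem f)

/-- The unique index in degree one. -/
def peirceIndexOne : (peirceChain he hf).I 1 := PUnit.unit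

/-- The generators of `fRe` in degree two. -/
def peirceGen (i : (peirceChain he hf).I 2) : peirceComponent f e :=
  ⟨(peirceChain he hf).a 1 i (peirceIndexOne he hf), (peirceChain he hf).a 1 i _, by
    have h1 := (peirceChain he hf).left 1 i (peirceIndexOne he hf)
    have h2 := (peirceChain he hf).right 1 i (peirceIndexOne he hf)
    rw [peirceChain_h_one] at h2
    rw [peirceChain_h] at h1
    rw [h1, h2]⟩

theorem leftEval_peirceGen (q : (peirceChain he hf).I 2 →₀ hf.Corner) :
    (leftEval (peirceGen he hf) q : R) =
      (peirceChain he hf).d R 1 (finsuppMap _ (cornerVal hf) q) (peirceIndexOne he hf) := by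
  induction q using Finsupp.induction_linear with
  | zero => simp only [map_zero]; rfl
  | add a b ha hb =>
    rw [map_add, map_add, map_add, Finsupp.add_apply, AddSubgroup.coe_add, ha, hb]
  | single i r =>
    rw [leftEval_single, finsuppMap_single, MatChain.d_single]
    rfl

theorem leftEval_peirceGen_surjective :
    Function.Surjective (leftEval (L := hf.Corner) (peirceGen he hf)) := by
  rintro ⟨_, r, rfl⟩
  let q : (peirceChain he hf).I 1 →₀ R := Finsupp.single (peirceIndexOne he hf) (f * r * e)
  have hq : ∀ k, q k = f * r * e := fun _ => Finsupp.single_eq_same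
  let i : (peirceChain he hf).I 2 := ⟨q,
    fun k => (congrArg (f * ·) (hq k)).trans
      (((mul_assoc f (f * r) e).symm.trans (by rw [← mul_assoc, hf.eq])).trans (hq k).symm),
    fun k => (congrArg (· * e) (hq k)).trans
      (((mul_assoc (f * r) e e).trans (by rw [he.eq])).trans (hq k).symm),
    Finsupp.ext fun k => k.elim⟩
  refine ⟨Finsupp.single i 1, ?_⟩
  rw [leftEval_single, one_smul]
  exact Subtype.ext (hq _)

/-- With coefficients in `eR` the terms from index 2 on are sums of copies of `eRf`, that is, `eRf`
tensored over `fRf` with the free resolution of `fRe`. Index `j + 3` here is resolution degree `j +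
1`. -/
theorem acyc_of_subsingleton_peirce_tor (j : ℕ)
    (h : Subsingleton (NCTor hf.Corner (j + 1) (peirceComponent e f) (peirceComponent f e))) :
    (peirceChain he hf).Acyc (fixedRightIdeal e) (j + 2) := by
  have hd : ∀ q : (peirceChain he hf).I 2 →₀ hf.Corner, leftEval (peirceGen he hf) q = 0 ↔
      (peirceChain he hf).d R 1 (finsuppMap _ (cornerVal hf) q) = 0 := by
    intro q
    rw [← ZeroMemClass.coe_eq_zero, leftEval_peirceGen]
    refine ⟨fun h => Finsupp.ext fun k => h, fun h => ?_⟩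
    rw [h]
    rfl
  refine acyc_of_acyc_cornerChain he hf (N := peirceComponent e f)
    { toFun := fun n => ⟨n.1, by
        obtain ⟨_, r, rfl⟩ := n
        rw [mem_fixedRightIdeal, ← mul_assoc, ← mul_assoc, he.eq]⟩
      map_zero' := rfl
      map_add' := fun _ _ => rfl } (fun _ _ => rfl)
    (fun m n hmn => Subtype.ext (congrArg (fun z => (z.1 : R)) hmn)) (fun m hm => ?_) ?_
  · refine ⟨⟨m.1, m.1, ?_⟩, rfl⟩
    rw [m.2]
    exact congrArg Subtype.val hm
  · refine (cornerChain he hf).acyc_of_subsingleton_tor (peirceGen he hf)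
      (leftEval_peirceGen_surjective he hf) (fun _ => rfl)
      (fun q hq => exists_rowMap_cornerRow_eq he hf 0 q ((hd q).1 hq)) (fun i => (hd _).2 ?_)
      (acyc_cornerChain_corner he hf) _ j h
    refine (congrArg _ (cornerRow_spec he hf 0 i)).trans ?_
    exact (peirceChain he hf).comp 1 i

end CornerTor

/-! ### Projective covers relative to an idempotent -/

section Cover

variable {R : Type u} [Ring R] {e f : R}

/-- Left multiplication by `g' x` as a map `gR → g'R`. -/
def peirceMap (g : R) {g' : R} (hg' : IsIdempotentElem g') (x : R) :
    fixedRightIdeal g →ₗ[Rᵐᵒᵖ] fixedRightIdeal g' :=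
  (toFixedRightIdeal g' (g' * x) (by rw [← mul_assoc, hg'.eq])).comp (Submodule.subtype _)

@[simp]
theorem peirceMap_coe (g : R) {g' : R} (hg' : IsIdempotentElem g') (x : R)
    (r : fixedRightIdeal g) : (peirceMap g hg' x r : R) = g' * x * r := rfl

theorem fixedRightIdeal_hom_eq {g : R} (hg : IsIdempotentElem g) {M : Type u} [AddCommGroup M]
    [Module Rᵐᵒᵖ M] (φ : fixedRightIdeal g →ₗ[Rᵐᵒᵖ] M) (r : fixedRightIdeal g) :
    φ r = MulOpposite.op (r : R) • φ ⟨g, hg⟩ := by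
  rw [← map_smul]
  congr 1
  exact Subtype.ext r.2.symm

theorem fixedRightIdeal_hom_smul {g : R} (hg : IsIdempotentElem g) {M : Type u} [AddCommGroup M]
    [Module Rᵐᵒᵖ M] (φ : fixedRightIdeal g →ₗ[Rᵐᵒᵖ] M) :
    MulOpposite.op g • φ ⟨g, hg⟩ = φ ⟨g, hg⟩ :=
  (fixedRightIdeal_hom_eq hg φ ⟨g, hg⟩).symm

theorem projective_self_op : Module.Projective Rᵐᵒᵖ R := by
  refine Module.Projective.of_lifting_property'' fun g hg => ?_
  obtain ⟨y, hy⟩ := hg 1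
  refine ⟨orbitMap y, LinearMap.ext fun r => ?_⟩
  change g (MulOpposite.op r • y) = r
  rw [map_smul, hy]
  exact one_mul r

theorem finite_self_op : Module.Finite Rᵐᵒᵖ R :=
  ⟨⟨{1}, eq_top_iff.2 fun r _ => by
    rw [Finset.coe_singleton, Submodule.mem_span_singleton]
    exact ⟨MulOpposite.op r, one_mul r⟩⟩⟩

theorem projective_fixedRightIdeal {g : R} (hg : IsIdempotentElem g) :
    Module.Projective Rᵐᵒᵖ (fixedRightIdeal g) := by
  have := projective_self_op (R := R)
  exact Module.Projective.of_split (Submodule.subtype _) (toFixedRightIdeal g g hg)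
    (LinearMap.ext fun r => Subtype.ext r.2)

theorem finite_fixedRightIdeal {g : R} (hg : IsIdempotentElem g) :
    Module.Finite Rᵐᵒᵖ (fixedRightIdeal g) := by
  have := finite_self_op (R := R)
  exact Module.Finite.of_surjective (toFixedRightIdeal g g hg) fun r => ⟨r, Subtype.ext r.2⟩

/-- A projective module `⨁ g_i R` with all `g_i ∈ {e, f}` together with a surjection onto `M` whose
kernel has its `eR`-coordinates in the radical. -/
structure PeirceCover (e f : R) (M : Type u) [AddCommGroup M] [Module Rᵐᵒᵖ M] where
  /-- the index set -/
  ι : Type u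
  fintype : Fintype ι
  /-- the idempotents -/
  g : ι → R
  g_eq : ∀ i, g i = e ∨ g i = f
  /-- the surjection -/
  π : (∀ i, fixedRightIdeal (g i)) →ₗ[Rᵐᵒᵖ] M
  surjective : Function.Surjective π
  minimal : ∀ x, π x = 0 → ∀ i, g i = e → (x i : R) ∈ Ring.jacobson R

theorem smul_smul_op {M : Type u} [AddCommGroup M] [Module Rᵐᵒᵖ M] (r s : R) (m : M) :
    MulOpposite.op r • MulOpposite.op s • m = MulOpposite.op (s * r) • m := by
  rw [smul_smul, MulOpposite.op_mul]

/-- An element `x` of `eR` outside the radical has a right multiple equal to `e`: `exe` is outside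
the radical too and is invertible in `eRe` modulo the radical, and the error is absorbed by a unit
`1 - j`. -/
theorem IsLocalPeirce.mem_of_smul_mem (he : IsLocalPeirce e) {M : Type u} [AddCommGroup M]
    [Module Rᵐᵒᵖ M] (N : Submodule Rᵐᵒᵖ M) {m : M} (hm : MulOpposite.op e • m = m) {x : R}
    (hx : e * x = x) (hxJ : x ∉ Ring.jacobson R) (h : MulOpposite.op x • m ∈ N) : m ∈ N := by
  have hexe : e * x * e ∉ Ring.jacobson R := fun h => hxJ (by
    have h2 := add_mem h (he.right x)
    rwa [← mul_add, add_sub_cancel, mul_one, hx] at h2)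
  obtain ⟨y, hy⟩ := he.inv x hexe
  set j := e - (e * x * e) * (e * y * e) with hj
  have hej : e * j = j := by
    rw [hj, mul_sub, he.idem.eq]
    simp only [← mul_assoc, he.idem.eq]
  obtain ⟨v, hv⟩ := isUnit_one_sub_of_mem_jacobson hy
  have h1 : x * (e * e * y * e * ↑v⁻¹) = e := by
    calc x * (e * e * y * e * ↑v⁻¹) = (e * x * e) * (e * y * e) * ↑v⁻¹ := by
          rw [hx]; noncomm_ring
      _ = e * (1 - j) * ↑v⁻¹ := by
          rw [mul_sub, hej, mul_one, hj, sub_sub_cancel]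
      _ = e := by rw [← hv, mul_assoc, Units.mul_inv, mul_one]
  have h2 := N.smul_mem (MulOpposite.op (e * e * y * e * ↑v⁻¹)) h
  rwa [smul_smul_op, h1, hm] at h2

/-- Split generators into their `e`-parts and `f`-parts and take as few `e`-generators as possible.
A relation with an `e`-coordinate outside the radical would make that generator redundant. No
minimality is needed of the `f`-generators. -/
theorem IsLocalPeirce.exists_cover (he : IsLocalPeirce e) (M : Type u)
    [AddCommGroup M] [Module Rᵐᵒᵖ M] [Module.Finite Rᵐᵒᵖ M] :
    Nonempty (PeirceCover e (1 - e) M) := by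
  classical
  set f := 1 - e with hf
  let p : ℕ → Prop := fun n => ∃ A B : Finset M, A.card = n ∧
    (∀ a ∈ A, MulOpposite.op e • a = a) ∧ (∀ b ∈ B, MulOpposite.op f • b = b) ∧
    Submodule.span Rᵐᵒᵖ (A ∪ B : Set M) = ⊤
  have hex : ∃ n, p n := by
    obtain ⟨G, hG⟩ := Module.Finite.fg_top (R := Rᵐᵒᵖ) (M := M)
    refine ⟨_, G.image (fun m => MulOpposite.op e • m), G.image (fun m => MulOpposite.op f • m),
      rfl, ?_, ?_, ?_⟩
    · intro a ha
      obtain ⟨m, _, rfl⟩ := Finset.mem_image.1 ha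
      rw [smul_smul_op, he.idem.eq]
    · intro a ha
      obtain ⟨m, _, rfl⟩ := Finset.mem_image.1 ha
      rw [smul_smul_op, he.idem.one_sub.eq]
    · rw [eq_top_iff, ← hG, Submodule.span_le]
      intro m hm
      have h1 : m = MulOpposite.op e • m + MulOpposite.op f • m := by
        rw [← add_smul, ← MulOpposite.op_add, hf, add_sub_cancel, MulOpposite.op_one, one_smul]
      rw [h1]
      exact add_mem
        (Submodule.subset_span (Or.inl (Finset.mem_coe.2 (Finset.mem_image_of_mem _ hm))))
        (Submodule.subset_span (Or.inr (Finset.mem_coe.2 (Finset.mem_image_of_mem _ hm))))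
  obtain ⟨A, B, hcard, hA, hB, hspan⟩ := Nat.find_spec hex
  let g : A ⊕ B → R := Sum.elim (fun _ => e) (fun _ => f)
  let c : A ⊕ B → M := Sum.elim Subtype.val Subtype.val
  have hg : ∀ i, IsIdempotentElem (g i) := by
    rintro (a | b)
    · exact he.idem
    · exact he.idem.one_sub
  have hc : ∀ i, MulOpposite.op (g i) • c i = c i := by
    rintro (a | b)
    · exact hA _ a.2
    · exact hB _ b.2
  let π : (∀ i, fixedRightIdeal (g i)) →ₗ[Rᵐᵒᵖ] M :=
    ∑ i, ((orbitMap (c i)).comp (Submodule.subtype _)).comp (LinearMap.proj i)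
  have hπ : ∀ x, π x = ∑ i, MulOpposite.op (x i : R) • c i := fun x => by
    simp only [π, LinearMap.sum_apply]
    rfl
  have hπs : ∀ i, π (Pi.single i ⟨g i, hg i⟩) = c i := by
    intro i
    rw [hπ, Finset.sum_eq_single i]
    · rw [Pi.single_eq_same, hc]
    · intro j _ hj
      rw [Pi.single_eq_of_ne hj]
      exact zero_smul _ _
    · simp
  refine ⟨⟨A ⊕ B, inferInstance, g, ?_, π, ?_, ?_⟩⟩
  · rintro (a | b)
    · exact Or.inl rfl
    · exact Or.inr rfl
  · rw [← LinearMap.range_eq_top, eq_top_iff, ← hspan, Submodule.span_le]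
    rintro m (hm | hm)
    · exact ⟨_, hπs (Sum.inl ⟨m, hm⟩)⟩
    · exact ⟨_, hπs (Sum.inr ⟨m, hm⟩)⟩
  · intro x hx i hi
    rcases i with a | b
    · by_contra hxJ
      set N := Submodule.span Rᵐᵒᵖ ((A.erase a : Finset M) ∪ B : Set M) with hN
      have hmem : ∀ j, j ≠ Sum.inl a → c j ∈ N := by
        rintro (a' | b) hj
        · refine Submodule.subset_span (Or.inl (Finset.mem_coe.2 (Finset.mem_erase.2 ⟨?_, a'.2⟩)))
          exact fun h => hj (congrArg Sum.inl (Subtype.ext h))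
        · exact Submodule.subset_span (Or.inr b.2)
      have haN : (a : M) ∈ N := by
        refine he.mem_of_smul_mem N (hA _ a.2) (x (Sum.inl a)).2 hxJ ?_
        rw [hπ, ← Finset.add_sum_erase _ _ (Finset.mem_univ (Sum.inl a))] at hx
        change MulOpposite.op (x (Sum.inl a) : R) • c (Sum.inl a) ∈ N
        rw [eq_neg_of_add_eq_zero_left hx]
        refine neg_mem (Submodule.sum_mem _ fun j hj => N.smul_mem _ (hmem j ?_))
        exact Finset.ne_of_mem_erase hj
      have htop : N = ⊤ := by
        rw [eq_top_iff, ← hspan, Submodule.span_le]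
        rintro m (hm | hm)
        · by_cases h : m = a
          · rw [h]
            exact haN
          · exact hmem (Sum.inl ⟨m, hm⟩) fun h' => h (congrArg Subtype.val (Sum.inl_injective h'))
        · exact hmem (Sum.inr ⟨m, hm⟩) Sum.inr_ne_inl
      refine Nat.find_min hex (m := (A.erase a).card) ?_ ⟨A.erase a, B, rfl,
        fun m hm => hA m (Finset.mem_of_mem_erase hm), hB, htop⟩
      rw [← hcard]
      exact Finset.card_erase_lt_of_mem a.2
    -- For an `f`-generator, `g i = e` would mean `1 - e = e`, hence `e = e(1 - e) = 0`.
    · exfalso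
      have h1 : (1 : R) - e = e := hi
      apply he.notMem
      have h2 : e = e * e := he.idem.eq.symm
      rw [h2]
      nth_rewrite 2 [← h1]
      rw [mul_sub, mul_one, he.idem.eq, sub_self]
      exact zero_mem _

namespace PeirceCover

variable {M : Type u} [AddCommGroup M] [Module Rᵐᵒᵖ M] (P : PeirceCover e f M)

instance : Fintype P.ι := P.fintype

/-- The projective module of a cover. -/
abbrev proj : Type u := ∀ i, fixedRightIdeal (P.g i)

/-- The kernel of a cover. -/
abbrev ker : Type u := LinearMap.ker P.π

theorem isIdempotentElem (he : IsIdempotentElem e) (hf : IsIdempotentElem f) (i : P.ι) :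
    IsIdempotentElem (P.g i) := by
  rcases P.g_eq i with h | h <;> rw [h] <;> assumption

theorem exact : Function.Exact (Submodule.subtype (LinearMap.ker P.π)) P.π :=
  LinearMap.exact_subtype_ker_map _

theorem projective (he : IsIdempotentElem e) (hf : IsIdempotentElem f) :
    Module.Projective Rᵐᵒᵖ P.proj := by
  classical
  have := fun i => projective_fixedRightIdeal (P.isIdempotentElem he hf i)
  exact Module.Projective.of_equiv
    (DFinsupp.linearEquivFunOnFintype (R := Rᵐᵒᵖ) (M := fun i => fixedRightIdeal (P.g i)))

theorem finite_ker (he : IsIdempotentElem e) (hf : IsIdempotentElem f) [IsNoetherianRing Rᵐᵒᵖ] :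
    Module.Finite Rᵐᵒᵖ P.ker := by
  have := fun i => finite_fixedRightIdeal (P.isIdempotentElem he hf i)
  infer_instance

theorem acyc (C : MatChain R) {j : ℕ} (h : ∀ i, C.Acyc (fixedRightIdeal (P.g i)) j) :
    C.Acyc P.proj j := by
  classical
  refine C.acyc_of_dualBasis (fun i => fixedRightIdeal (P.g i)) (fun i => LinearMap.proj i)
    (fun i => LinearMap.single Rᵐᵒᵖ (fun i => fixedRightIdeal (P.g i)) i) 
    (fun m => ⟨Finset.univ, fun F hF => ?_⟩) h
  rw [Finset.univ_subset_iff.1 hF]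
  exact Finset.univ_sum_single m

end PeirceCover

end Cover

/-! ### The top of `eR` -/

section Top

variable {R : Type u} [Ring R] {e : R}

/-- `S` is generated by an element whose annihilator is that of the top of `eR`. -/
structure IsTopGenerator (e : R) {S : Type u} [AddCommGroup S] [Module Rᵐᵒᵖ S] (s : S) : Prop where
  gen : ∀ t : S, ∃ r : R, MulOpposite.op r • s = t
  ann : ∀ r : R, MulOpposite.op r • s = 0 ↔ e * r ∈ Ring.jacobson R

/-- The radical of `eR` is its intersection with `J`: this intersection is maximal by
`mem_of_smul_mem`, and a maximal submodule not containing it would contain some `e(1 - j)` with `j ∈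
J`, which generates `eR`. The generator is the class of `e`. -/
theorem IsLocalPeirce.exists_isTopGenerator (he : IsLocalPeirce e) :
    ∃ s : topModule e, IsTopGenerator e s := by
  let E := principalRightIdeal e
  have hE : ∀ x, x ∈ E ↔ e * x = x := by
    intro x
    rw [Submodule.mem_span_singleton]
    constructor
    · rintro ⟨r, rfl⟩
      change e * (e * r.unop) = e * r.unop
      rw [← mul_assoc, he.idem.eq]
    · exact fun h => ⟨MulOpposite.op x, h⟩
  let ε : E := ⟨e, (hE e).2 he.idem⟩
  have hε : ∀ x : E, MulOpposite.op (x : R) • ε = x := fun x => Subtype.ext ((hE _).1 x.2)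
  have htop : ∀ N : Submodule Rᵐᵒᵖ E, ε ∈ N → N = ⊤ := fun N h =>
    eq_top_iff.2 fun x _ => hε x ▸ N.smul_mem _ h
  let N₀ : Submodule Rᵐᵒᵖ E :=
    { carrier := {x | (x : R) ∈ Ring.jacobson R}
      add_mem' := fun {x y} hx hy => (add_mem (S := Ideal R) hx hy :
        (x : R) + y ∈ Ring.jacobson R)
      zero_mem' := zero_mem (Ring.jacobson R)
      smul_mem' := fun r x hx => (Ideal.mul_mem_right r.unop (Ring.jacobson R) hx :
        (x : R) * r.unop ∈ Ring.jacobson R) }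
  have hN₀ : IsCoatom N₀ := by
    refine ⟨fun h => he.notMem (h ▸ Submodule.mem_top : ε ∈ N₀), fun N hN => ?_⟩
    obtain ⟨x, hxN, hx⟩ := SetLike.exists_of_lt hN
    refine htop N (he.mem_of_smul_mem N (m := ε) (Subtype.ext he.idem) ((hE _).1 x.2) hx ?_)
    rwa [hε]
  have hjac : Module.jacobson Rᵐᵒᵖ E = N₀ := by
    refine le_antisymm (sInf_le hN₀) (le_sInf fun N hN => ?_)
    by_contra hle
    have hsup : N ⊔ N₀ = ⊤ := hN.2 _ (left_lt_sup.2 hle)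
    obtain ⟨n, hn, j, hj, hnj⟩ := Submodule.mem_sup.1 (hsup ▸ Submodule.mem_top : ε ∈ N ⊔ N₀)
    obtain ⟨v, hv⟩ := isUnit_one_sub_of_mem_jacobson (x := (j : R)) hj
    apply hN.1
    apply htop
    have h1 : ε = MulOpposite.op (↑v⁻¹ : R) • n := by
      apply Subtype.ext
      have h2 : (n : R) = e * v := by
        rw [hv, mul_sub, (hE _).1 j.2, mul_one]
        exact eq_sub_of_add_eq (congrArg Subtype.val hnj)
      change e = (n : R) * ↑v⁻¹
      rw [h2, mul_assoc, Units.mul_inv, mul_one]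
    rw [h1]
    exact N.smul_mem _ hn
  refine ⟨Submodule.Quotient.mk ε, fun t => ?_, fun r => ?_⟩
  · obtain ⟨x, rfl⟩ := Submodule.Quotient.mk_surjective _ t
    exact ⟨x, by rw [← Submodule.Quotient.mk_smul, hε]⟩
  · rw [← Submodule.Quotient.mk_smul, Submodule.Quotient.mk_eq_zero]
    change MulOpposite.op r • ε ∈ Module.jacobson Rᵐᵒᵖ E ↔ _
    rw [hjac]
    exact Iff.rfl

namespace IsTopGenerator

variable {S : Type u} [AddCommGroup S] [Module Rᵐᵒᵖ S] {s : S}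

theorem smul_eq_zero_of_mem (hs : IsTopGenerator e s) {j : R} (hj : j ∈ Ring.jacobson R) (t : S) :
    MulOpposite.op j • t = 0 := by
  obtain ⟨r, rfl⟩ := hs.gen t
  rw [smul_smul_op, hs.ann]
  exact Ideal.mul_mem_left _ _ (Ideal.mul_mem_left _ _ hj)

theorem smul_one_sub (hs : IsTopGenerator e s) (he : IsLocalPeirce e) (t : S) :
    MulOpposite.op (1 - e) • t = 0 := by
  obtain ⟨r, rfl⟩ := hs.gen t
  rw [smul_smul_op, hs.ann, ← mul_assoc]
  exact he.right r

theorem smul_self (hs : IsTopGenerator e s) (he : IsLocalPeirce e) (t : S) :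
    MulOpposite.op e • t = t := by
  have h := hs.smul_one_sub he t
  rw [MulOpposite.op_sub, sub_smul, sub_eq_zero, MulOpposite.op_one, one_smul] at h
  exact h.symm

theorem ne_zero (hs : IsTopGenerator e s) (he : IsLocalPeirce e) : s ≠ 0 := by
  intro h
  apply he.notMem
  have h1 := (hs.ann 1).1 (by rw [h, smul_zero])
  rwa [mul_one] at h1

theorem finite (hs : IsTopGenerator e s) : Module.Finite Rᵐᵒᵖ S :=
  ⟨⟨{s}, eq_top_iff.2 fun t _ => by
    rw [Finset.coe_singleton, Submodule.mem_span_singleton]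
    obtain ⟨r, hr⟩ := hs.gen t
    exact ⟨_, hr⟩⟩⟩

/-- Homomorphisms from the projective module of a cover to the top of `eR` vanish on elements
whose `eR`-coordinates are in the radical. -/
theorem hom_eq_zero (hs : IsTopGenerator e s) (he : IsLocalPeirce e)
    {M : Type u} [AddCommGroup M] [Module Rᵐᵒᵖ M]
    (P : PeirceCover e (1 - e) M) (φ : P.proj →ₗ[Rᵐᵒᵖ] S) (x : P.proj)
    (hx : ∀ i, P.g i = e → (x i : R) ∈ Ring.jacobson R) : φ x = 0 := by
  classical
  rw [← Finset.univ_sum_single x, map_sum]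
  refine Finset.sum_eq_zero fun i _ => ?_
  have hi := P.isIdempotentElem he.idem he.idem.one_sub i
  have h1 := fixedRightIdeal_hom_eq hi
    (φ.comp (LinearMap.single Rᵐᵒᵖ (fun i => fixedRightIdeal (P.g i)) i)) (x i)
  refine h1.trans ?_
  rcases P.g_eq i with h | h
  · exact hs.smul_eq_zero_of_mem (hx i h) _
  · have h2 := fixedRightIdeal_hom_smul hi
      (φ.comp (LinearMap.single Rᵐᵒᵖ (fun i => fixedRightIdeal (P.g i)) i))
    have h3 := congrArg MulOpposite.op h
    rw [← h2, h3, hs.smul_one_sub he, smul_zero]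

theorem exists_g_eq_of_hom_ne_zero (hs : IsTopGenerator e s) (he : IsLocalPeirce e)
    {M : Type u} [AddCommGroup M]
    [Module Rᵐᵒᵖ M] (P : PeirceCover e (1 - e) M) (φ : M →ₗ[Rᵐᵒᵖ] S) (hφ : φ ≠ 0) :
    ∃ i, P.g i = e := by
  by_contra hcon
  push Not at hcon
  apply hφ
  ext m
  obtain ⟨x, rfl⟩ := P.surjective m
  exact hs.hom_eq_zero he P (φ.comp P.π) x fun i hi => absurd hi (hcon i)

/-- The coordinate map `eR → S`, `e ↦ s`, kills the kernel of the cover because `S` is annihilated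
by the radical, so it descends to `M`. -/
theorem exists_hom_ne_zero (hs : IsTopGenerator e s) (he : IsLocalPeirce e)
    {M : Type u} [AddCommGroup M]
    [Module Rᵐᵒᵖ M] (P : PeirceCover e (1 - e) M) (i : P.ι) (hi : P.g i = e) :
    ∃ φ : M →ₗ[Rᵐᵒᵖ] S, φ ≠ 0 := by
  classical
  let ψ : P.proj →ₗ[Rᵐᵒᵖ] S :=
    ((orbitMap s).comp (Submodule.subtype _)).comp (LinearMap.proj i)
  have hψ : ∀ x, ψ x = MulOpposite.op (x i : R) • s := fun _ => rfl
  let φ := (LinearMap.ker P.π).liftQ ψ (fun x hx => by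
    rw [LinearMap.mem_ker, hψ]
    exact hs.smul_eq_zero_of_mem (P.minimal x hx i hi) _)
  refine ⟨φ.comp (P.π.quotKerEquivOfSurjective P.surjective).symm.toLinearMap, fun h => ?_⟩
  have hidem := P.isIdempotentElem he.idem he.idem.one_sub i
  let x : P.proj := Pi.single i ⟨P.g i, hidem⟩
  have h1 := LinearMap.congr_fun h (P.π x)
  have h2 : (P.π.quotKerEquivOfSurjective P.surjective).symm (P.π x) =
      Submodule.Quotient.mk x := by
    rw [LinearEquiv.symm_apply_eq]
    rfl
  rw [LinearMap.comp_apply, LinearEquiv.coe_coe, h2] at h1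
  have h3 : ψ x = 0 := h1
  rw [hψ] at h3
  simp only [x, Pi.single_eq_same] at h3
  rw [hi, hs.smul_self he] at h3
  exact hs.ne_zero he h3

end IsTopGenerator

end Top

/-! ### Dimension shifting for `Ext` -/

section ExtShift

variable {R : Type u} [Ring R]

theorem subsingleton_rightExt_zero_iff (M S : Type u) [AddCommGroup M] [Module Rᵐᵒᵖ M]
    [AddCommGroup S] [Module Rᵐᵒᵖ S] :
    Subsingleton (rightExt R 0 M S) ↔ ∀ φ : M →ₗ[Rᵐᵒᵖ] S, φ = 0 := by
  constructor
  · intro h φ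
    have h1 : Abelian.Ext.mk₀ (ModuleCat.ofHom φ) = Abelian.Ext.mk₀ (ModuleCat.ofHom 0) :=
      Subsingleton.elim _ _
    exact congrArg ModuleCat.Hom.hom (Abelian.Ext.addEquiv₀.symm.injective h1)
  · intro h
    refine subsingleton_of_forall_eq 0 fun x => ?_
    obtain ⟨g, rfl⟩ := Abelian.Ext.addEquiv₀.symm.surjective x
    have : g = 0 := ModuleCat.hom_ext (h g.hom)
    rw [this, map_zero]

variable {K P M S : Type u} [AddCommGroup K] [Module Rᵐᵒᵖ K] [AddCommGroup P] [Module Rᵐᵒᵖ P]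
  [AddCommGroup M] [Module Rᵐᵒᵖ M] [AddCommGroup S] [Module Rᵐᵒᵖ S]
  {ι : K →ₗ[Rᵐᵒᵖ] P} {π : P →ₗ[Rᵐᵒᵖ] M}

/-- Dimension shifting along a projective module all of whose homomorphisms to `S` vanish on the
kernel. -/
theorem subsingleton_rightExt_succ_iff (hι : Function.Injective ι) (hπ : Function.Surjective π)
    (hex : Function.Exact ι π) (hP : Module.Projective Rᵐᵒᵖ P)
    (hS : ∀ φ : P →ₗ[Rᵐᵒᵖ] S, φ.comp ι = 0) (k : ℕ) :
    Subsingleton (rightExt R (k + 1) M S) ↔ Subsingleton (rightExt R k K S) := by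
  have hproj : Projective (ModuleCat.of Rᵐᵒᵖ P) := (IsProjective.iff_projective _).1 hP
  let C : ShortComplex (ModuleCat.{u} Rᵐᵒᵖ) := ShortComplex.mk (ModuleCat.ofHom ι)
    (ModuleCat.ofHom π) (ModuleCat.hom_ext (LinearMap.ext fun x => hex.apply_apply_eq_zero x))
  have hC : C.ShortExact :=
    { exact := (ShortComplex.moduleCat_exact_iff _).2 fun x hx => (hex x).1 hx
      mono_f := (ModuleCat.mono_iff_injective _).2 hι
      epi_g := (ModuleCat.epi_iff_surjective _).2 hπ }
  constructor
  · intro h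
    refine subsingleton_of_forall_eq 0 fun x => ?_
    obtain ⟨y, rfl⟩ := Abelian.Ext.contravariant_sequence_exact₁ hC (ModuleCat.of Rᵐᵒᵖ S) x
      (n₁ := k + 1) (add_comm 1 k) (Subsingleton.elim _ _)
    -- In degree 0 the map `Hom(P, S) → Hom(K, S)` vanishes by `hS`; in positive degrees
    -- projectivity kills the Ext group of `P`.
    cases k with
    | zero =>
      obtain ⟨g, rfl⟩ := Abelian.Ext.addEquiv₀.symm.surjective y
      change (Abelian.Ext.mk₀ C.f).comp (Abelian.Ext.mk₀ g) (zero_add 0) = 0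
      rw [Abelian.Ext.mk₀_comp_mk₀]
      have : C.f ≫ g = 0 := ModuleCat.hom_ext (hS g.hom)
      rw [this, Abelian.Ext.mk₀_zero]
    | succ k =>
      have : y = 0 := Abelian.Ext.eq_zero_of_projective y
      rw [this, Abelian.Ext.comp_zero]
  · intro h
    refine subsingleton_of_forall_eq 0 fun x => ?_
    obtain ⟨y, rfl⟩ := Abelian.Ext.contravariant_sequence_exact₃ hC (ModuleCat.of Rᵐᵒᵖ S) x
      (Abelian.Ext.eq_zero_of_projective _) (n₀ := k) (add_comm 1 k)
    have : y = 0 := Subsingleton.elim (α := rightExt R k K S) _ _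
    rw [this, Abelian.Ext.comp_zero]

theorem IsTopGenerator.subsingleton_rightExt_ker_iff {e : R} {s : S} (hs : IsTopGenerator e s)
    (he : IsLocalPeirce e) (P : PeirceCover e (1 - e) M) (k : ℕ) :
    Subsingleton (rightExt R (k + 1) M S) ↔ Subsingleton (rightExt R k P.ker S) :=
  subsingleton_rightExt_succ_iff (K := P.ker) (ι := Submodule.subtype (LinearMap.ker P.π))
    Subtype.val_injective P.surjective P.exact
    (P.projective he.idem he.idem.one_sub)
    (fun φ => LinearMap.ext fun x => hs.hom_eq_zero he P φ x (P.minimal x x.2)) k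

end ExtShift

/-! ### Non-exactness of minimal resolutions -/

section Main

variable {R : Type u} [Ring R] {e : R}

namespace IsLocalPeirce

variable (he : IsLocalPeirce e)

/-- The complex of left modules attached to `e` and `1 - e`. -/
abbrev chain : MatChain R := peirceChain he.idem he.idem.one_sub

/-- A cycle of degree `j + 1` with coefficients in `M`. -/
structure IsCycle {M : Type u} [AddCommGroup M] [Module Rᵐᵒᵖ M] (j : ℕ)
    (v : he.chain.I (j + 1) →₀ M) : Prop where
  proj_eq : he.chain.proj M (j + 1) v = v
  d_eq : he.chain.d M j v = 0

theorem IsCycle.map {M M' : Type u} [AddCommGroup M] [Module Rᵐᵒᵖ M] [AddCommGroup M']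
    [Module Rᵐᵒᵖ M'] (φ : M →ₗ[Rᵐᵒᵖ] M') {j : ℕ} {v : he.chain.I (j + 1) →₀ M}
    (hv : he.IsCycle j v) : he.IsCycle j (he.chain.map φ _ v) :=
  ⟨by rw [← MatChain.map_proj, hv.proj_eq], by rw [← MatChain.map_d, hv.d_eq, map_zero]⟩

/-- The boundaries of degree `j + 1` with coefficients in `M`. -/
noncomputable abbrev boundaries (M : Type u) [AddCommGroup M] [Module Rᵐᵒᵖ M] (j : ℕ) :
    AddSubgroup (he.chain.I (j + 1) →₀ M) :=
  (he.chain.d M (j + 1)).range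

theorem map_mem_boundaries {M M' : Type u} [AddCommGroup M] [Module Rᵐᵒᵖ M] [AddCommGroup M']
    [Module Rᵐᵒᵖ M'] (φ : M →ₗ[Rᵐᵒᵖ] M') {j : ℕ} {v : he.chain.I (j + 1) →₀ M}
    (hv : v ∈ he.boundaries M j) : he.chain.map φ _ v ∈ he.boundaries M' j := by
  obtain ⟨w, rfl⟩ := hv
  exact ⟨he.chain.map φ _ w, (MatChain.map_d _ _ _ _).symm⟩

/-- The ideal generated by `1 - e` acts trivially on the homology with coefficients in `eR`. -/
theorem map_peirceMap_mem_of_mem_span {x : R} (hx : x ∈ TwoSidedIdeal.span {1 - e}) {j : ℕ}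
    {u : he.chain.I (j + 1) →₀ fixedRightIdeal e} (hu : he.IsCycle j u) :
    he.chain.map (peirceMap e he.idem x) _ u ∈ he.boundaries (fixedRightIdeal e) j := by
  rw [TwoSidedIdeal.mem_span_iff_mem_addSubgroup_closure] at hx
  induction hx using AddSubgroup.closure_induction with
  | mem x hx =>
    obtain ⟨y, ⟨a, -, z, hz, rfl⟩, b, -, rfl⟩ := hx
    obtain rfl : z = 1 - e := hz
    -- Multiplication by `a(1 - e)b` factors through `(1 - e)R`, which has no homology.
    have h1 : he.chain.map (peirceMap e he.idem (a * (1 - e) * b)) (j + 1) u =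
        he.chain.map (peirceMap (1 - e) he.idem a) (j + 1)
          (he.chain.map (peirceMap e he.idem.one_sub b) (j + 1) u) := by
      ext i
      simp only [MatChain.map_apply, peirceMap_coe, mul_assoc]
    change he.chain.map (peirceMap e he.idem (a * (1 - e) * b)) (j + 1) u ∈ _
    rw [h1]
    refine he.map_mem_boundaries _ ?_
    have h2 := hu.map he (peirceMap e he.idem.one_sub b)
    exact acyc_fixedRightIdeal he.idem he.idem.one_sub j _ h2.proj_eq h2.d_eq
  | zero =>
    have h1 : he.chain.map (peirceMap e he.idem 0) (j + 1) u = 0 := by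
      ext i
      simp
    rw [h1]
    exact zero_mem _
  | add x y _ _ hx hy =>
    have h1 : he.chain.map (peirceMap e he.idem (x + y)) (j + 1) u =
        he.chain.map (peirceMap e he.idem x) (j + 1) u +
          he.chain.map (peirceMap e he.idem y) (j + 1) u := by
      ext i
      simp [mul_add, add_mul]
    rw [h1]
    exact add_mem hx hy
  | neg x _ hx =>
    have h1 : he.chain.map (peirceMap e he.idem (-x)) (j + 1) u =
        -he.chain.map (peirceMap e he.idem x) (j + 1) u := by
      ext i
      simp
    rw [h1]
    exact neg_mem hx

/-- The homology with coefficients in `eR`, if nonzero, has a nonzero class annihilated by the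
radical of `eRe`. -/
theorem exists_socle_cycle (hK : IsArtinianRing (quotientBySpan (1 - e))ᵐᵒᵖ) {j : ℕ}
    (hj : ¬ he.chain.Acyc (fixedRightIdeal e) j) :
    ∃ u : he.chain.I (j + 1) →₀ fixedRightIdeal e, he.IsCycle j u ∧
      u ∉ he.boundaries (fixedRightIdeal e) j ∧ ∀ x ∈ Ring.jacobson R,
        he.chain.map (peirceMap e he.idem x) _ u ∈ he.boundaries (fixedRightIdeal e) j := by
  obtain ⟨N, hN⟩ := exists_list_prod_mem_of_isArtinianRing _ hK
  by_contra hcon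
  push Not at hcon
  have h0 : ∃ u, he.IsCycle j u ∧ u ∉ he.boundaries (fixedRightIdeal e) j := by
    by_contra h
    push Not at h
    exact hj fun v hv hdv => h v ⟨hv, hdv⟩
  obtain ⟨u, hu, hub⟩ := h0
  have key : ∀ n, ∃ l : List R, (∀ x ∈ l, x ∈ Ring.jacobson R) ∧ l.length = n ∧
      he.chain.map (peirceMap e he.idem l.prod) _ u ∉ he.boundaries (fixedRightIdeal e) j := by
    intro n
    induction n with
    | zero =>
      refine ⟨[], by simp, rfl, ?_⟩
      have h1 : he.chain.map (peirceMap e he.idem ([] : List R).prod) (j + 1) u = u := by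
        ext i
        rw [List.prod_nil, MatChain.map_apply, peirceMap_coe, mul_one, (u i).2]
      rwa [h1]
    | succ n ih =>
      obtain ⟨l, hl, hlen, hlb⟩ := ih
      obtain ⟨x, hx, hxb⟩ := hcon _ (hu.map he _) hlb
      -- The factor `e` matches the composite of two maps `peirceMap`, each of which multiplies by
      -- `e` on the left.
      refine ⟨x * e :: l, ?_, by rw [List.length_cons, hlen], ?_⟩
      · intro y hy
        rcases List.mem_cons.1 hy with rfl | hy
        · exact Ideal.mul_mem_right _ _ hx
        · exact hl y hy
      · have h1 : he.chain.map (peirceMap e he.idem (x * e :: l).prod) (j + 1) u =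
            he.chain.map (peirceMap e he.idem x) (j + 1)
              (he.chain.map (peirceMap e he.idem l.prod) (j + 1) u) := by
          ext i
          simp [mul_assoc]
        rwa [h1]
  obtain ⟨l, hl, hlen, hlb⟩ := key N
  exact hlb (he.map_peirceMap_mem_of_mem_span (hN l hl hlen) hu)

/-- Homomorphisms into a sum of copies of `eR` and `(1-e)R` sending `e` into the radical in the
`eR`-coordinates kill socle cycles. -/
theorem map_mem_boundaries_of_radical {j : ℕ} {u : he.chain.I (j + 1) →₀ fixedRightIdeal e}
    (hu : he.IsCycle j u) (hsoc : ∀ x ∈ Ring.jacobson R,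
      he.chain.map (peirceMap e he.idem x) _ u ∈ he.boundaries (fixedRightIdeal e) j)
    {g : R} (hg : g = e ∨ g = 1 - e) (θ : fixedRightIdeal e →ₗ[Rᵐᵒᵖ] fixedRightIdeal g)
    (hθ : g = e → ∀ r, (θ r : R) ∈ Ring.jacobson R) :
    he.chain.map θ _ u ∈ he.boundaries (fixedRightIdeal g) j := by
  rcases hg with rfl | rfl
  · have h1 : θ = peirceMap g he.idem (θ ⟨g, he.idem⟩ : R) := by
      ext r
      rw [fixedRightIdeal_hom_eq he.idem θ r, peirceMap_coe, (θ ⟨g, he.idem⟩).2]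
      rfl
    rw [h1]
    exact hsoc _ (hθ rfl _)
  · have h2 := hu.map he θ
    exact acyc_fixedRightIdeal he.idem he.idem.one_sub j _ h2.proj_eq h2.d_eq

theorem mem_boundaries_pi {ι : Type u} [Fintype ι] (g : ι → R) {j : ℕ}
    (v : he.chain.I (j + 1) →₀ ∀ i, fixedRightIdeal (g i))
    (h : ∀ i, he.chain.map (LinearMap.proj i) _ v ∈ he.boundaries (fixedRightIdeal (g i)) j) :
    v ∈ he.boundaries (∀ i, fixedRightIdeal (g i)) j := by
  classical
  have h1 : v = ∑ i, he.chain.map (LinearMap.single Rᵐᵒᵖ (fun i => fixedRightIdeal (g i)) i) _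
      (he.chain.map (LinearMap.proj i) _ v) := by
    ext k : 1
    rw [Finsupp.finsetSum_apply]
    simp only [MatChain.map_apply]
    exact (Finset.univ_sum_single (v k)).symm
  rw [h1]
  exact sum_mem fun i _ => he.map_mem_boundaries _ (h i)

variable {S : Type u} [AddCommGroup S] [Module Rᵐᵒᵖ S] {s : S}

/-- A finitely generated module without extensions by the top of `eR` has no homology. -/
theorem acyc_of_subsingleton_rightExt [IsNoetherianRing Rᵐᵒᵖ] (hs : IsTopGenerator e s) (j : ℕ) :
    ∀ (M : Type u) [AddCommGroup M] [Module Rᵐᵒᵖ M] [Module.Finite Rᵐᵒᵖ M],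
      (∀ k, Subsingleton (rightExt R k M S)) → he.chain.Acyc M j := by
  induction j with
  | zero =>
    intro M _ _ _ hM
    obtain ⟨P⟩ := he.exists_cover M
    -- As `Hom(M, S) = 0`, the cover involves no copy of `eR`, so it has no homology.
    have hg : ∀ i, P.g i = 1 - e := fun i => (P.g_eq i).resolve_left fun hi => by
      obtain ⟨φ, hφ⟩ := hs.exists_hom_ne_zero he P i hi
      exact hφ ((subsingleton_rightExt_zero_iff M S).1 (hM 0) φ)
    refine he.chain.acyc_right (K := P.ker) (ι := Submodule.subtype (LinearMap.ker P.π))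
      Subtype.val_injective P.surjective P.exact (P.acyc _ fun i => ?_) ?_
    · rw [hg]
      exact acyc_fixedRightIdeal _ _ _
    · intro v _ _
      -- Index 0 of the complex is the empty set.
      exact ⟨0, Finsupp.ext fun k => k.elim⟩
  | succ j ih =>
    intro M _ _ _ hM
    obtain ⟨P⟩ := he.exists_cover M
    have := P.finite_ker he.idem he.idem.one_sub
    have hg : ∀ i, P.g i = 1 - e := fun i => (P.g_eq i).resolve_left fun hi => by
      obtain ⟨φ, hφ⟩ := hs.exists_hom_ne_zero he P i hi
      exact hφ ((subsingleton_rightExt_zero_iff M S).1 (hM 0) φ)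
    refine he.chain.acyc_right (K := P.ker) (ι := Submodule.subtype (LinearMap.ker P.π))
      Subtype.val_injective P.surjective P.exact (P.acyc _ fun i => ?_) ?_
    · rw [hg]
      exact acyc_fixedRightIdeal _ _ _
    · rintro v hv ⟨w, hw⟩
      refine ih P.ker (fun k => (hs.subsingleton_rightExt_ker_iff he P k).1 (hM _)) v hv ?_
      refine he.chain.map_injective (ι := Submodule.subtype (LinearMap.ker P.π))
        Subtype.val_injective _ ?_
      rw [MatChain.map_d, ← hw, MatChain.d_d, map_zero]

/-- A finitely generated module with nonzero homomorphisms but no higher extensions to the top of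
`eR` has a nonzero homology class killed by all radical maps into projective modules. -/
theorem exists_cycle_of_hom_ne_zero [IsNoetherianRing Rᵐᵒᵖ] (hs : IsTopGenerator e s)
    (hK : IsArtinianRing (quotientBySpan (1 - e))ᵐᵒᵖ) {m : ℕ}
    (hm : ¬ he.chain.Acyc (fixedRightIdeal e) m) (M : Type u) [AddCommGroup M] [Module Rᵐᵒᵖ M]
    [Module.Finite Rᵐᵒᵖ M] (h0 : ¬ Subsingleton (rightExt R 0 M S))
    (hM : ∀ k, Subsingleton (rightExt R (k + 1) M S)) :
    ∃ v : he.chain.I (m + 1) →₀ M, he.IsCycle m v ∧ v ∉ he.boundaries M m ∧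
      ∀ {ι : Type u} [Fintype ι] (g : ι → R) (_ : ∀ i, g i = e ∨ g i = 1 - e)
        (φ : M →ₗ[Rᵐᵒᵖ] ∀ i, fixedRightIdeal (g i))
        (_ : ∀ x i, g i = e → (φ x i : R) ∈ Ring.jacobson R),
        he.chain.map φ _ v ∈ he.boundaries (∀ i, fixedRightIdeal (g i)) m := by
  classical
  obtain ⟨u, hu, hub, hsoc⟩ := he.exists_socle_cycle hK hm
  obtain ⟨P⟩ := he.exists_cover M
  have := P.finite_ker he.idem he.idem.one_sub
  rw [subsingleton_rightExt_zero_iff] at h0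
  push Not at h0
  obtain ⟨ψ, hψ⟩ := h0
  obtain ⟨i₀, hi₀⟩ := hs.exists_g_eq_of_hom_ne_zero he P ψ hψ
  have hker : he.chain.Acyc P.ker m := he.acyc_of_subsingleton_rightExt hs m P.ker
    fun k => (hs.subsingleton_rightExt_ker_iff he P k).1 (hM k)
  have hidem := P.isIdempotentElem he.idem he.idem.one_sub i₀
  -- Since `P.g i₀ = e`, multiplication by 1 identifies `eR` with the summand at `i₀`, so `σ` is a
  -- split inclusion with retraction `ρ`.
  let σ : fixedRightIdeal e →ₗ[Rᵐᵒᵖ] P.proj :=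
    (LinearMap.single Rᵐᵒᵖ (fun i => fixedRightIdeal (P.g i)) i₀).comp (peirceMap e hidem 1)
  let ρ : P.proj →ₗ[Rᵐᵒᵖ] fixedRightIdeal e :=
    (peirceMap (P.g i₀) he.idem 1).comp (LinearMap.proj i₀)
  have hρσ : ∀ r, ρ (σ r) = r := by
    intro r
    apply Subtype.ext
    have h1 : (ρ (σ r) : R) = e * 1 * (P.g i₀ * 1 * r) := by
      simp [ρ, σ]
    rw [h1, hi₀, mul_one, r.2, r.2]
  refine ⟨he.chain.map P.π _ (he.chain.map σ _ u), (hu.map he σ).map he P.π, fun hb => hub ?_,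
    fun g hg φ hφ => ?_⟩
  -- The kernel has no homology, so a boundary in `M` is already one in the cover, and then in the
  -- summand `eR`.
  · have h1 := he.chain.exists_d_eq_of_map_right (K := P.ker)
      (ι := Submodule.subtype (LinearMap.ker P.π)) Subtype.val_injective P.surjective P.exact hker
      _ (hu.map he σ).proj_eq (hu.map he σ).d_eq hb
    have h2 := he.map_mem_boundaries ρ (v := he.chain.map σ _ u) h1
    have h3 : he.chain.map ρ _ (he.chain.map σ (m + 1) u) = u := by
      ext k : 1
      exact hρσ _
    rwa [h3] at h2
  · refine he.mem_boundaries_pi g _ fun i => ?_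
    have h1 : he.chain.map (LinearMap.proj i) (m + 1) (he.chain.map φ (m + 1)
        (he.chain.map P.π (m + 1) (he.chain.map σ (m + 1) u))) =
        he.chain.map ((LinearMap.proj i).comp (φ.comp (P.π.comp σ))) (m + 1) u := by
      ext k
      rfl
    rw [h1]
    exact he.map_mem_boundaries_of_radical hu hsoc (hg i) _ (fun hi r => hφ _ i hi)

/-- Let `n + 1` be the largest degree in which a finitely generated module `M` has extensions by the
top of `eR`, and `m` the largest degree in which `eR` has homology. Then `M` has homology in degree
`m + n + 1`. -/
theorem not_acyc_of_rightExt [IsNoetherianRing Rᵐᵒᵖ] (hs : IsTopGenerator e s)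
    (hK : IsArtinianRing (quotientBySpan (1 - e))ᵐᵒᵖ) {m : ℕ}
    (hm : ¬ he.chain.Acyc (fixedRightIdeal e) m)
    (hm' : ∀ j, m < j → he.chain.Acyc (fixedRightIdeal e) j) (n : ℕ) :
    ∀ (M : Type u) [AddCommGroup M] [Module Rᵐᵒᵖ M] [Module.Finite Rᵐᵒᵖ M],
      ¬ Subsingleton (rightExt R (n + 1) M S) →
      (∀ k, n + 1 < k → Subsingleton (rightExt R k M S)) → ¬ he.chain.Acyc M (m + n + 1) := by
  induction n with
  | zero =>
    intro M _ _ _ h1 hk hac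
    obtain ⟨P⟩ := he.exists_cover M
    have := P.finite_ker he.idem he.idem.one_sub
    obtain ⟨v, hv, hvb, hvφ⟩ := he.exists_cycle_of_hom_ne_zero hs hK hm P.ker
      (fun h => h1 ((hs.subsingleton_rightExt_ker_iff he P 0).2 h))
      (fun k => (hs.subsingleton_rightExt_ker_iff he P (k + 1)).1 (hk _ (by omega)))
    -- Minimality of the cover says that the inclusion of its kernel is radical in the
    -- `eR`-coordinates, so the class of `v` dies in the cover.
    obtain ⟨w, hw⟩ := hvφ P.g P.g_eq (Submodule.subtype (LinearMap.ker P.π))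
      (fun x i hi => P.minimal x x.2 i hi)
    exact hvb (he.chain.exists_d_eq_of_map_left (K := P.ker) (j := m)
      (ι := Submodule.subtype (LinearMap.ker P.π)) Subtype.val_injective P.surjective P.exact hac v
      ⟨w, hw⟩)
  | succ n ih =>
    intro M _ _ _ h1 hk hac
    obtain ⟨P⟩ := he.exists_cover M
    have := P.finite_ker he.idem he.idem.one_sub
    refine ih P.ker (fun h => h1 ((hs.subsingleton_rightExt_ker_iff he P _).2 h))
      (fun k hk' => (hs.subsingleton_rightExt_ker_iff he P k).1 (hk _ (by omega))) ?_
    -- The degree in question is `m + n + 1 > m`, where neither `eR` nor `(1 - e)R` has homology.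
    refine he.chain.acyc_left (ι := Submodule.subtype (LinearMap.ker P.π)) Subtype.val_injective
      P.surjective P.exact (P.acyc _ fun i => ?_) hac
    rcases P.g_eq i with h | h <;> rw [h]
    · exact hm' _ (by omega)
    · exact acyc_fixedRightIdeal _ _ _

end IsLocalPeirce

end Main

/-! ### Largest nonvanishing degrees and the final contradiction -/

theorem Set.Finite.exists_maximal_nat {p : ℕ → Prop} (h : {k | p k}.Finite) {k₀ : ℕ} (h₀ : p k₀) :
    ∃ k, k₀ ≤ k ∧ p k ∧ ∀ j, k < j → ¬ p j := by
  obtain ⟨k, hk, hmax⟩ := h.exists_le_maximal h₀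
  exact ⟨k, hk, hmax.1, fun j hj hp => absurd (hmax.2 hp hj.le) (not_le.2 hj)⟩

theorem mainTheorem4 (R : Type u) [Ring R]
    (hleft : IsNoetherianRing R) (hright : IsNoetherianRing Rᵐᵒᵖ)
    (hsemiperfect : IsSemiperfectRing R) (hbasic : IsBasicRing R)
    (e : R) (he : IsPrimitiveIdempotent e)
    (hartin : IsArtinianRing (quotientBySpan (1 - e))ᵐᵒᵖ)
    (htor : {k : ℕ | Nontrivial (NCTor he.isIdempotentElem.one_sub.Corner k
      (peirceComponent e (1 - e)) (peirceComponent (1 - e) e))}.Finite)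
    (hext : {k : ℕ | Nontrivial (rightExt R k (topModule e) (topModule e))}.Finite) :
    ∀ k : ℕ, 1 ≤ k → Subsingleton (rightExt R k (topModule e) (topModule e)) := by
  have hl := he.isLocalPeirce hsemiperfect hbasic
  obtain ⟨s, hs⟩ := hl.exists_isTopGenerator
  have hfin := hs.finite
  have hacyc : {j : ℕ | ¬ hl.chain.Acyc (fixedRightIdeal e) j}.Finite := by
    obtain ⟨b, hb⟩ := htor.bddAbove
    -- Degree `i + 2` is controlled by `Tor_{i+1}`, so a bound `b` for Tor becomes `b + 1`, which
    -- also leaves out degrees 0 and 1.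
    refine (Set.finite_Iic (b + 1)).subset fun j hj => ?_
    by_contra hjb
    simp only [Set.mem_Iic, not_le] at hjb
    obtain ⟨i, rfl⟩ := Nat.exists_eq_add_of_le' (show 2 ≤ j by omega)
    refine hj (acyc_of_subsingleton_peirce_tor _ _ i
      (not_nontrivial_iff_subsingleton.1 fun h => ?_))
    have := hb (show i + 1 ∈ _ from h)
    omega
  obtain ⟨m, -, hm, hm'⟩ := hacyc.exists_maximal_nat
    (not_acyc_zero hl.idem hl.idem.one_sub hl.right hl.notMem)
  intro k hk
  by_contra hcon
  obtain ⟨n, hkn, hn, hn'⟩ := hext.exists_maximal_nat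
    (not_subsingleton_iff_nontrivial.1 hcon)
  obtain ⟨n, rfl⟩ := Nat.exists_eq_add_of_le' (hk.trans hkn)
  -- `S_e` would have homology in degree `m + n + 1 ≥ 1`, where its complex is zero because `S_e(1 -
  -- e) = 0`.
  exact hl.not_acyc_of_rightExt hs hartin hm (fun j hj => not_not.1 (hm' j hj)) n (topModule e)
    (not_subsingleton_iff_nontrivial.2 hn)
    (fun j hj => not_nontrivial_iff_subsingleton.1 (hn' j hj))
    (acyc_of_smul_eq_zero _ _ (hs.smul_one_sub hl) _)
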